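/- Let $\Phi=\{\varphi_m\}_{m=1}^\infty$ be a family of nondecreasing continuous functions $\varphi_m:[0,\infty)\to\mathbb R$ such that for each $m\in\mathbb N$: $i_1)$ $\lim_{x\to+\infty}\varphi_m(x)/x=+\infty$; $i_2)$ for each $A>0$ there is a constant $C(m,A)>0$ with $\varphi_m(x)+A\ln(1+x)\le\varphi_{m+1}(x)+C(m,A)$ for all $x\ge 0$. Assume moreover: $i_3)$ for each $m\in\mathbb N$ there is $a_m>0$ such that $\varphi_m(2x)\le\varphi_{m+1}(x)+a_m$ for all $x\ge0$; $i_5)$ for each $m\in\mathbb N$ there are $h_m>1$ and $l_m>0$ such that $2\varphi_m(x)\le\varphi_{m+1}(h_m x)+l_m$ for all $x\ge0$. For $\nu\in\mathbb N$ let $E(\varphi_\nu)$ be the space of all entire functions $f$ on $\mathbb C^n$ such that $$p_{\nu,k}(f)=\sup_{z\in\mathbb C^n}\frac{|f(z)|(1+\|z\|)^k}{e^{\varphi_\nu(\|\operatorname{Im}z\|)}}<\infty\quad\text{for all }k\in\mathbb Z_+,$$ with the topology of the norms $p_{\nu,k}$, $k\in\mathbb Z_+$, and let $E(\Phi)=\bigcup_\nu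 E(\varphi_\nu)$ with the locally convex inductive limit topology of the spaces $E(\varphi_\nu)$ (the finest locally convex vector space topology for which all the inclusions $E(\varphi_\nu)\to E(\Phi)$ are continuous). Put $\psi_\nu(x)=\varphi_\nu(e^x)$ for $x\ge 0$ and $\psi_\nu^*(x)=\sup_{y\ge0}(xy-\psi_\nu(y))$ for $x\ge 0$. Let $G(\psi_\nu^*)$ be the space of all $f\in C^\infty(\mathbb R^n)$ (complex-valued) such that $$\|f\|_{m,\psi_\nu^*}=\sup_{x\in\mathbb R^n,\ |\alpha|\le m,\ \beta\in\mathbb Z_+^n}\frac{|x^\beta (D^\alpha f)(x)|}{|\beta|!\,e^{-\psi_\nu^*(|\beta|)}}<\infty\quad\text{for all }m\in\mathbb Z_+,$$ with the topology of the norms $\|\cdot\|_{m,\psi_\nu^*}$, $m\in\mathbb Z_+$, and let $G(\Psi^*)=\bigcup_\nu G(\psi_\nu^*)$ with the locally convex inductive limit topology of the spaces $G(\psi_\nu^*)$. Then for each $f\in E(\Phi)$ the integral $$\hat f(x)=\int_{\mathbb R^n}f(\xi)e^{-i\langle x,\xi\rangle}\,d\xi,\qquad x\in\mathbb R^n,$$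 converges absolutely, and the Fourier transformation $f\mapsto\hat f$ is a linear topological isomorphism of $E(\Phi)$ onto $G(\Psi^*)$. -/

import Mathlib

open scoped ContDiff NNReal

noncomputable section

/-! ### Weight families -/

/-- A family `φ₀, φ₁, φ₂, …` of nondecreasing continuous functions `[0, ∞) → ℝ` (represented by
functions on `ℝ` of which only the values on `[0, ∞)` matter) that grow faster than linearly, with
`φ_m(x) + A ln (1 + x) ≤ φ_{m+1}(x) + C(m, A)`. The indices start at `0`. -/
structure WeightFamily where
  /-- the members of the family -/
  toFun : ℕ → ℝ → ℝ
  continuousOn : ∀ m, ContinuousOn (toFun m) (Set.Ici 0)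
  monotoneOn : ∀ m, MonotoneOn (toFun m) (Set.Ici 0)
  superlinear : ∀ m, Filter.Tendsto (fun x : ℝ => toFun m x / x) Filter.atTop Filter.atTop
  add_log_le : ∀ m, ∀ A : ℝ, 0 < A → ∃ C : ℝ, 0 < C ∧ ∀ x : ℝ, 0 ≤ x →
    toFun m x + A * Real.log (1 + x) ≤ toFun (m + 1) x + C

instance : CoeFun WeightFamily (fun _ => ℕ → ℝ → ℝ) := ⟨WeightFamily.toFun⟩

/-- The Young conjugate `g*(x) = sup_{y ≥ 0} (x y - g y)`. -/
def youngConj (g : ℝ → ℝ) (x : ℝ) : ℝ := ⨆ y : ℝ≥0, (x * (y : ℝ) - g (y : ℝ))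

/-- The Young conjugate `ψ_ν*` of `ψ_ν(x) = φ_ν(e^x)`. -/
def WeightFamily.psiStar (Φ : WeightFamily) (ν : ℕ) : ℝ → ℝ :=
  youngConj (fun x => Φ ν (Real.exp x))

/-! ### Locally convex inductive limits -/

/-- The inductive limit topology on a complex vector space `V` with respect to linear maps
`j i : X i → V` from topological vector spaces: the finest locally convex vector space topology on
`V` for which all the `j i` are continuous. (In Mathlib's order on topologies finer is smaller; the
infimum of a set of locally convex vector space topologies is again one.) -/
@[reducible]
def indLimTopology {ι : Type} {X : ι → Type} [∀ i, AddCommGroup (X i)] [∀ i, Module ℂ (X i)]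
    [∀ i, TopologicalSpace (X i)] {V : Type} [AddCommGroup V] [Module ℂ V]
    (j : ∀ i, X i →ₗ[ℂ] V) : TopologicalSpace V :=
  sInf {t : TopologicalSpace V | @IsTopologicalAddGroup V t _ ∧ @ContinuousSMul ℂ V _ _ t ∧
    @LocallyConvexSpace ℝ V _ _ _ (Module.complexToReal V) t ∧
    ∀ i, @Continuous (X i) V _ t (j i)}

/-! ### The spaces of entire functions -/

/-- The vector `Im z ∈ ℝⁿ` of imaginary parts of `z ∈ ℂⁿ`. -/
def imVec {n : ℕ} (z : EuclideanSpace ℂ (Fin n)) : EuclideanSpace ℝ (Fin n) :=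
  WithLp.toLp 2 (fun j => (z j).im)

/-- The real vector `x ∈ ℝⁿ` as an element of `ℂⁿ`. -/
def realToComplex {n : ℕ} (x : EuclideanSpace ℝ (Fin n)) : EuclideanSpace ℂ (Fin n) :=
  WithLp.toLp 2 (fun j => ((x j : ℝ) : ℂ))

/-- `|f(z)| (1 + ‖z‖)^k / e^{φ(‖Im z‖)}`. -/
def eTerm {n : ℕ} (φ : ℝ → ℝ) (k : ℕ) (f : EuclideanSpace ℂ (Fin n) → ℂ)
    (z : EuclideanSpace ℂ (Fin n)) : ℝ :=
  ‖f z‖ * (1 + ‖z‖) ^ k / Real.exp (φ ‖imVec z‖)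

theorem eTerm_nonneg {n : ℕ} (φ : ℝ → ℝ) (k : ℕ) (f : EuclideanSpace ℂ (Fin n) → ℂ)
    (z : EuclideanSpace ℂ (Fin n)) : 0 ≤ eTerm φ k f z := by
  unfold eTerm; positivity

theorem eTerm_add_le {n : ℕ} (φ : ℝ → ℝ) (k : ℕ) (f g : EuclideanSpace ℂ (Fin n) → ℂ)
    (z : EuclideanSpace ℂ (Fin n)) : eTerm φ k (f + g) z ≤ eTerm φ k f z + eTerm φ k g z := by
  unfold eTerm
  rw [← add_div, ← add_mul]
  have := norm_add_le (f z) (g z)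
  simp only [Pi.add_apply]
  gcongr

theorem eTerm_smul {n : ℕ} (φ : ℝ → ℝ) (k : ℕ) (c : ℂ) (f : EuclideanSpace ℂ (Fin n) → ℂ)
    (z : EuclideanSpace ℂ (Fin n)) : eTerm φ k (c • f) z = ‖c‖ * eTerm φ k f z := by
  simp only [eTerm, Pi.smul_apply, norm_smul]
  ring

/-- The space `E(φ)` of all entire functions `f` on `ℂⁿ` such that, for every `k`,
`sup_z |f(z)| (1 + ‖z‖)^k / e^{φ(‖Im z‖)} < ∞`. -/
def eSubmodule (n : ℕ) (φ : ℝ → ℝ) : Submodule ℂ (EuclideanSpace ℂ (Fin n) → ℂ) where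
  carrier := {f | Differentiable ℂ f ∧ ∀ k : ℕ, BddAbove (Set.range (eTerm φ k f))}
  zero_mem' := by
    refine ⟨differentiable_const 0, fun k => ⟨0, ?_⟩⟩
    rintro _ ⟨z, rfl⟩
    simp [eTerm]
  add_mem' := by
    rintro f g ⟨hf, hf'⟩ ⟨hg, hg'⟩
    refine ⟨hf.add hg, fun k => ?_⟩
    obtain ⟨A, hA⟩ := hf' k
    obtain ⟨B, hB⟩ := hg' k
    refine ⟨A + B, ?_⟩
    rintro _ ⟨z, rfl⟩
    exact (eTerm_add_le φ k f g z).trans (add_le_add (hA ⟨z, rfl⟩) (hB ⟨z, rfl⟩))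
  smul_mem' := by
    rintro c f ⟨hf, hf'⟩
    refine ⟨hf.const_smul c, fun k => ?_⟩
    obtain ⟨A, hA⟩ := hf' k
    refine ⟨‖c‖ * A, ?_⟩
    rintro _ ⟨z, rfl⟩
    rw [eTerm_smul]
    exact mul_le_mul_of_nonneg_left (hA ⟨z, rfl⟩) (norm_nonneg c)

/-- `E(φ)` as a type; it carries the topology of the norms `eNorm n φ k`, `k = 0, 1, 2, …`. -/
def EStep (n : ℕ) (φ : ℝ → ℝ) : Type := ↥(eSubmodule n φ)

instance (n : ℕ) (φ : ℝ → ℝ) : AddCommGroup (EStep n φ) :=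
  inferInstanceAs (AddCommGroup ↥(eSubmodule n φ))

instance (n : ℕ) (φ : ℝ → ℝ) : Module ℂ (EStep n φ) :=
  inferInstanceAs (Module ℂ ↥(eSubmodule n φ))

/-- The norm `p_k(f) = sup_z |f(z)| (1 + ‖z‖)^k / e^{φ(‖Im z‖)}` on `E(φ)`. -/
def eNorm (n : ℕ) (φ : ℝ → ℝ) (k : ℕ) : Seminorm ℂ (EStep n φ) :=
  Seminorm.of (fun f => ⨆ z : EuclideanSpace ℂ (Fin n), eTerm φ k f.1 z)
    (by
      intro f g
      refine ciSup_le fun z => (eTerm_add_le φ k f.1 g.1 z).trans ?_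
      exact add_le_add (le_ciSup (f.2.2 k) z) (le_ciSup (g.2.2 k) z))
    (by
      intro c f
      have h : ∀ z, eTerm φ k (c • f).1 z = ‖c‖ * eTerm φ k f.1 z := eTerm_smul φ k c f.1
      simp only [h]
      exact (Real.mul_iSup_of_nonneg (norm_nonneg c) _).symm)

instance (n : ℕ) (φ : ℝ → ℝ) : TopologicalSpace (EStep n φ) :=
  SeminormFamily.moduleFilterBasis (𝕜 := ℂ) (eNorm n φ) |>.topology

theorem eSubmodule_le_succ (n : ℕ) (Φ : WeightFamily) (ν : ℕ) :
    eSubmodule n (Φ ν) ≤ eSubmodule n (Φ (ν + 1)) := by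
  rintro f ⟨hf, hf'⟩
  refine ⟨hf, fun k => ?_⟩
  obtain ⟨A, hA⟩ := hf' k
  obtain ⟨C, -, hC⟩ := Φ.add_log_le ν 1 one_pos
  refine ⟨Real.exp C * A, ?_⟩
  rintro _ ⟨z, rfl⟩
  refine le_trans ?_ (mul_le_mul_of_nonneg_left (hA ⟨z, rfl⟩) (Real.exp_pos C).le)
  have h1 := hC ‖imVec z‖ (norm_nonneg _)
  have h2 : 0 ≤ Real.log (1 + ‖imVec z‖) :=
    Real.log_nonneg (by linarith [norm_nonneg (imVec z)])
  have h3 : Real.exp (Φ ν ‖imVec z‖) ≤ Real.exp C * Real.exp (Φ (ν + 1) ‖imVec z‖) := by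
    rw [← Real.exp_add]
    exact Real.exp_le_exp.2 (by linarith)
  unfold eTerm
  rw [div_le_iff₀ (Real.exp_pos _), mul_comm (Real.exp C), mul_assoc, div_mul_eq_mul_div,
    le_div_iff₀ (Real.exp_pos _)]
  exact mul_le_mul_of_nonneg_left h3 (by positivity)

theorem eSubmodule_mono (n : ℕ) (Φ : WeightFamily) : Monotone fun ν => eSubmodule n (Φ ν) :=
  monotone_nat_of_le_succ (eSubmodule_le_succ n Φ)

/-- The union `E(Φ) = ⋃_ν E(φ_ν)` as a space of functions on `ℂⁿ`. -/
def eUnion (n : ℕ) (Φ : WeightFamily) : Submodule ℂ (EuclideanSpace ℂ (Fin n) → ℂ) where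
  carrier := {f | ∃ ν, f ∈ eSubmodule n (Φ ν)}
  zero_mem' := ⟨0, Submodule.zero_mem _⟩
  add_mem' := by
    rintro f g ⟨ν, hf⟩ ⟨μ, hg⟩
    exact ⟨max ν μ, Submodule.add_mem _ (eSubmodule_mono n Φ (le_max_left ν μ) hf)
      (eSubmodule_mono n Φ (le_max_right ν μ) hg)⟩
  smul_mem' := by
    rintro c f ⟨ν, hf⟩
    exact ⟨ν, Submodule.smul_mem _ c hf⟩

/-- `E(Φ)` as a type; it carries the inductive limit topology of the spaces `E(φ_ν)`. -/
def ESpace (n : ℕ) (Φ : WeightFamily) : Type := ↥(eUnion n Φ)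

instance (n : ℕ) (Φ : WeightFamily) : AddCommGroup (ESpace n Φ) :=
  inferInstanceAs (AddCommGroup ↥(eUnion n Φ))

instance (n : ℕ) (Φ : WeightFamily) : Module ℂ (ESpace n Φ) :=
  inferInstanceAs (Module ℂ ↥(eUnion n Φ))

instance (n : ℕ) (Φ : WeightFamily) :
    CoeFun (ESpace n Φ) (fun _ => EuclideanSpace ℂ (Fin n) → ℂ) := ⟨fun f => f.1⟩

/-- The inclusion `E(φ_ν) → E(Φ)`. -/
def eIncl (n : ℕ) (Φ : WeightFamily) (ν : ℕ) : EStep n (Φ ν) →ₗ[ℂ] ESpace n Φ :=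
  Submodule.inclusion (p := eSubmodule n (Φ ν)) (p' := eUnion n Φ) fun _ hf => ⟨ν, hf⟩

instance (n : ℕ) (Φ : WeightFamily) : TopologicalSpace (ESpace n Φ) :=
  indLimTopology (eIncl n Φ)

/-! ### Partial derivatives -/

/-- The partial derivative `∂f/∂x_j`. -/
def partialDeriv {n : ℕ} (j : Fin n) (f : EuclideanSpace ℝ (Fin n) → ℂ) :
    EuclideanSpace ℝ (Fin n) → ℂ :=
  fun x => lineDeriv ℝ f x (EuclideanSpace.single j (1 : ℝ))

/-- The partial derivative `D^α f = ∂₁^{α₁} ⋯ ∂ₙ^{αₙ} f`. -/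
def multiDeriv {n : ℕ} (α : Fin n → ℕ) (f : EuclideanSpace ℝ (Fin n) → ℂ) :
    EuclideanSpace ℝ (Fin n) → ℂ :=
  (List.finRange n).foldr (fun j g => (partialDeriv j)^[α j] g) f

theorem partialDeriv_eq_fderiv {n : ℕ} (j : Fin n) {f : EuclideanSpace ℝ (Fin n) → ℂ}
    (hf : ContDiff ℝ ∞ f) :
    partialDeriv j f = fun x => fderiv ℝ f x (EuclideanSpace.single j (1 : ℝ)) := by
  funext x
  exact ((hf.differentiable (by simp)) x).lineDeriv_eq_fderiv

theorem contDiff_partialDeriv {n : ℕ} (j : Fin n) {f : EuclideanSpace ℝ (Fin n) → ℂ}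
    (hf : ContDiff ℝ ∞ f) : ContDiff ℝ ∞ (partialDeriv j f) := by
  rw [partialDeriv_eq_fderiv j hf]
  exact (hf.fderiv_right (m := ∞) (by simp)).clm_apply contDiff_const

theorem partialDeriv_add {n : ℕ} (j : Fin n) {f g : EuclideanSpace ℝ (Fin n) → ℂ}
    (hf : ContDiff ℝ ∞ f) (hg : ContDiff ℝ ∞ g) :
    partialDeriv j (f + g) = partialDeriv j f + partialDeriv j g := by
  rw [partialDeriv_eq_fderiv j hf, partialDeriv_eq_fderiv j hg,
    partialDeriv_eq_fderiv (f := f + g) j (hf.add hg)]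
  funext x
  rw [fderiv_add ((hf.differentiable (by simp)) x) ((hg.differentiable (by simp)) x)]
  rfl

theorem partialDeriv_smul {n : ℕ} (j : Fin n) (c : ℂ) {f : EuclideanSpace ℝ (Fin n) → ℂ}
    (hf : ContDiff ℝ ∞ f) : partialDeriv j (c • f) = c • partialDeriv j f := by
  rw [partialDeriv_eq_fderiv j hf, partialDeriv_eq_fderiv (f := c • f) j (hf.const_smul c)]
  funext x
  rw [fderiv_const_smul ((hf.differentiable (by simp)) x)]
  rfl

theorem iterate_partialDeriv {n : ℕ} (j : Fin n) (k : ℕ) {f g : EuclideanSpace ℝ (Fin n) → ℂ}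
    (c : ℂ) (hf : ContDiff ℝ ∞ f) (hg : ContDiff ℝ ∞ g) :
    ContDiff ℝ ∞ ((partialDeriv j)^[k] f) ∧
    (partialDeriv j)^[k] (f + g) = (partialDeriv j)^[k] f + (partialDeriv j)^[k] g ∧
    (partialDeriv j)^[k] (c • f) = c • (partialDeriv j)^[k] f := by
  induction k generalizing f g with
  | zero => exact ⟨hf, rfl, rfl⟩
  | succ k ih =>
    simp only [Function.iterate_succ_apply, partialDeriv_add j hf hg, partialDeriv_smul j c hf]
    exact ih (contDiff_partialDeriv j hf) (contDiff_partialDeriv j hg)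

theorem foldr_partialDeriv {n : ℕ} (α : Fin n → ℕ) (l : List (Fin n))
    {f g : EuclideanSpace ℝ (Fin n) → ℂ} (c : ℂ) (hf : ContDiff ℝ ∞ f) (hg : ContDiff ℝ ∞ g) :
    ContDiff ℝ ∞ (l.foldr (fun j g => (partialDeriv j)^[α j] g) f) ∧
    l.foldr (fun j g => (partialDeriv j)^[α j] g) (f + g) =
      l.foldr (fun j g => (partialDeriv j)^[α j] g) f +
        l.foldr (fun j g => (partialDeriv j)^[α j] g) g ∧
    l.foldr (fun j g => (partialDeriv j)^[α j] g) (c • f) =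
      c • l.foldr (fun j g => (partialDeriv j)^[α j] g) f := by
  have smooth : ∀ {u : EuclideanSpace ℝ (Fin n) → ℂ}, ContDiff ℝ ∞ u → ∀ l : List (Fin n),
      ContDiff ℝ ∞ (l.foldr (fun j g => (partialDeriv j)^[α j] g) u) := by
    intro u hu l
    induction l with
    | nil => exact hu
    | cons j l ih => exact (iterate_partialDeriv j (α j) 0 ih ih).1
  induction l with
  | nil => exact ⟨hf, rfl, rfl⟩
  | cons j l ih =>
    have h := iterate_partialDeriv j (α j) c (smooth hf l) (smooth hg l)
    refine ⟨h.1, ?_, ?_⟩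
    · simp only [List.foldr_cons, ih.2.1, h.2.1]
    · simp only [List.foldr_cons, ih.2.2, h.2.2]

theorem multiDeriv_add {n : ℕ} (α : Fin n → ℕ) {f g : EuclideanSpace ℝ (Fin n) → ℂ}
    (hf : ContDiff ℝ ∞ f) (hg : ContDiff ℝ ∞ g) :
    multiDeriv α (f + g) = multiDeriv α f + multiDeriv α g :=
  (foldr_partialDeriv α _ 0 hf hg).2.1

theorem multiDeriv_smul {n : ℕ} (α : Fin n → ℕ) (c : ℂ) {f : EuclideanSpace ℝ (Fin n) → ℂ}
    (hf : ContDiff ℝ ∞ f) : multiDeriv α (c • f) = c • multiDeriv α f :=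
  (foldr_partialDeriv α _ c hf hf).2.2

/-! ### The spaces of smooth functions -/

/-- The index set of all `(x, α, β)` with `x ∈ ℝⁿ`, `|α| ≤ m` and `β ∈ ℤ₊ⁿ`. -/
abbrev GIndex (n m : ℕ) : Type :=
  EuclideanSpace ℝ (Fin n) × {α : Fin n → ℕ // ∑ i, α i ≤ m} × (Fin n → ℕ)

/-- `|x^β (D^α f)(x)| / (|β|! e^{-w(|β|)})`. -/
def gTerm {n m : ℕ} (w : ℝ → ℝ) (f : EuclideanSpace ℝ (Fin n) → ℂ) (t : GIndex n m) : ℝ :=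
  |∏ i, t.1 i ^ t.2.2 i| * ‖multiDeriv t.2.1.1 f t.1‖ /
    (((∑ i, t.2.2 i).factorial : ℝ) * Real.exp (-w ((∑ i, t.2.2 i : ℕ) : ℝ)))

theorem gTerm_nonneg {n m : ℕ} (w : ℝ → ℝ) (f : EuclideanSpace ℝ (Fin n) → ℂ)
    (t : GIndex n m) : 0 ≤ gTerm w f t := by
  unfold gTerm; positivity

theorem gTerm_add_le {n m : ℕ} (w : ℝ → ℝ) {f g : EuclideanSpace ℝ (Fin n) → ℂ}
    (hf : ContDiff ℝ ∞ f) (hg : ContDiff ℝ ∞ g) (t : GIndex n m) :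
    gTerm w (f + g) t ≤ gTerm w f t + gTerm w g t := by
  unfold gTerm
  rw [← add_div, ← mul_add, multiDeriv_add _ hf hg]
  have := norm_add_le (multiDeriv t.2.1.1 f t.1) (multiDeriv t.2.1.1 g t.1)
  simp only [Pi.add_apply]
  gcongr

theorem gTerm_smul {n m : ℕ} (w : ℝ → ℝ) (c : ℂ) {f : EuclideanSpace ℝ (Fin n) → ℂ}
    (hf : ContDiff ℝ ∞ f) (t : GIndex n m) : gTerm w (c • f) t = ‖c‖ * gTerm w f t := by
  unfold gTerm
  rw [multiDeriv_smul _ c hf]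
  simp only [Pi.smul_apply, norm_smul]
  ring

/-- The space `G(w)` of all smooth functions `f` on `ℝⁿ` such that, for every `m`,
`sup_{x, |α| ≤ m, β} |x^β (D^α f)(x)| / (|β|! e^{-w(|β|)}) < ∞`. -/
def gSubmodule (n : ℕ) (w : ℝ → ℝ) : Submodule ℂ (EuclideanSpace ℝ (Fin n) → ℂ) where
  carrier := {f | ContDiff ℝ ∞ f ∧
    ∀ m : ℕ, BddAbove (Set.range (gTerm w f : GIndex n m → ℝ))}
  zero_mem' := by
    have h0 : ContDiff ℝ ∞ (0 : EuclideanSpace ℝ (Fin n) → ℂ) := contDiff_const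
    refine ⟨h0, fun m => ⟨0, ?_⟩⟩
    rintro _ ⟨t, rfl⟩
    have h := gTerm_smul w 0 h0 t
    rw [smul_zero, norm_zero, zero_mul] at h
    exact h.le
  add_mem' := by
    rintro f g ⟨hf, hf'⟩ ⟨hg, hg'⟩
    refine ⟨hf.add hg, fun m => ?_⟩
    obtain ⟨A, hA⟩ := hf' m
    obtain ⟨B, hB⟩ := hg' m
    refine ⟨A + B, ?_⟩
    rintro _ ⟨t, rfl⟩
    exact (gTerm_add_le w hf hg t).trans (add_le_add (hA ⟨t, rfl⟩) (hB ⟨t, rfl⟩))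
  smul_mem' := by
    rintro c f ⟨hf, hf'⟩
    refine ⟨hf.const_smul c, fun m => ?_⟩
    obtain ⟨A, hA⟩ := hf' m
    refine ⟨‖c‖ * A, ?_⟩
    rintro _ ⟨t, rfl⟩
    rw [gTerm_smul w c hf]
    exact mul_le_mul_of_nonneg_left (hA ⟨t, rfl⟩) (norm_nonneg c)

/-- `G(w)` as a type; it carries the topology of the norms `gNorm n w m`, `m = 0, 1, 2, …`. -/
def GStep (n : ℕ) (w : ℝ → ℝ) : Type := ↥(gSubmodule n w)

instance (n : ℕ) (w : ℝ → ℝ) : AddCommGroup (GStep n w) :=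
  inferInstanceAs (AddCommGroup ↥(gSubmodule n w))

instance (n : ℕ) (w : ℝ → ℝ) : Module ℂ (GStep n w) :=
  inferInstanceAs (Module ℂ ↥(gSubmodule n w))

/-- The norm `‖f‖_m = sup_{x, |α| ≤ m, β} |x^β (D^α f)(x)| / (|β|! e^{-w(|β|)})` on `G(w)`. -/
def gNorm (n : ℕ) (w : ℝ → ℝ) (m : ℕ) : Seminorm ℂ (GStep n w) :=
  Seminorm.of (fun f => ⨆ t : GIndex n m, gTerm w f.1 t)
    (by
      intro f g
      have : Nonempty (GIndex n m) := ⟨(0, ⟨0, by simp⟩, 0)⟩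
      refine ciSup_le fun t => (gTerm_add_le w f.2.1 g.2.1 t).trans ?_
      exact add_le_add (le_ciSup (f.2.2 m) t) (le_ciSup (g.2.2 m) t))
    (by
      intro c f
      have h : ∀ t : GIndex n m, gTerm w (c • f).1 t = ‖c‖ * gTerm w f.1 t :=
        gTerm_smul w c f.2.1
      simp only [h]
      exact (Real.mul_iSup_of_nonneg (norm_nonneg c) _).symm)

instance (n : ℕ) (w : ℝ → ℝ) : TopologicalSpace (GStep n w) :=
  SeminormFamily.moduleFilterBasis (𝕜 := ℂ) (gNorm n w) |>.topology

/-- The supremum that defines `ψ_ν*(x)` is finite. -/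
theorem WeightFamily.bddAbove_psiStar (Φ : WeightFamily) (ν : ℕ) (x : ℝ) :
    BddAbove (Set.range fun y : ℝ≥0 => x * (y : ℝ) - Φ ν (Real.exp (y : ℝ))) := by
  obtain ⟨T, hT⟩ := Filter.eventually_atTop.1 ((Φ.superlinear ν).eventually_ge_atTop 1)
  set S : ℝ := max T 1 with hS
  have hS0 : 0 ≤ S := zero_le_one.trans (le_max_right T 1)
  have key : ∀ t : ℝ, 0 ≤ t → t - (S + |Φ ν 0|) ≤ Φ ν t := by
    intro t ht
    rcases le_total S t with h | h
    · have h1 := hT t ((le_max_left T 1).trans h)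
      have h2 : 0 < t := lt_of_lt_of_le one_pos ((le_max_right T 1).trans h)
      rw [le_div_iff₀ h2] at h1
      linarith [abs_nonneg (Φ ν 0)]
    · have h1 := Φ.monotoneOn ν (Set.mem_Ici.2 le_rfl) (Set.mem_Ici.2 ht) ht
      linarith [neg_abs_le (Φ ν 0)]
  refine ⟨x ^ 2 / 2 + (S + |Φ ν 0|), ?_⟩
  rintro _ ⟨y, rfl⟩
  have h1 := key (Real.exp y) (Real.exp_pos _).le
  have h2 := Real.quadratic_le_exp_of_nonneg y.2
  have h3 : (0 : ℝ) ≤ y := y.2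
  simp only [NNReal.val_eq_coe] at h2
  nlinarith [sq_nonneg (x - (y : ℝ))]

theorem WeightFamily.exists_psiStar_succ_le (Φ : WeightFamily) (ν : ℕ) :
    ∃ C : ℝ, ∀ x : ℝ, Φ.psiStar (ν + 1) x ≤ Φ.psiStar ν x + C := by
  obtain ⟨C, -, hC⟩ := Φ.add_log_le ν 1 one_pos
  refine ⟨C, fun x => ciSup_le fun y => ?_⟩
  have h1 := hC (Real.exp y) (Real.exp_pos _).le
  have h2 : 0 ≤ Real.log (1 + Real.exp y) :=
    Real.log_nonneg (by linarith [Real.exp_pos (y : ℝ)])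
  have h3 := le_ciSup (Φ.bddAbove_psiStar ν x) y
  have h4 : x * (y : ℝ) - Φ ν (Real.exp y) ≤ Φ.psiStar ν x := h3
  linarith

theorem gSubmodule_le_succ (n : ℕ) (Φ : WeightFamily) (ν : ℕ) :
    gSubmodule n (Φ.psiStar ν) ≤ gSubmodule n (Φ.psiStar (ν + 1)) := by
  rintro f ⟨hf, hf'⟩
  refine ⟨hf, fun m => ?_⟩
  obtain ⟨A, hA⟩ := hf' m
  obtain ⟨C, hC⟩ := Φ.exists_psiStar_succ_le ν
  refine ⟨Real.exp C * A, ?_⟩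
  rintro _ ⟨t, rfl⟩
  refine le_trans ?_ (mul_le_mul_of_nonneg_left (hA ⟨t, rfl⟩) (Real.exp_pos C).le)
  have h1 := hC ((∑ i, t.2.2 i : ℕ) : ℝ)
  have h3 : Real.exp (-Φ.psiStar ν ((∑ i, t.2.2 i : ℕ) : ℝ)) ≤
      Real.exp C * Real.exp (-Φ.psiStar (ν + 1) ((∑ i, t.2.2 i : ℕ) : ℝ)) := by
    rw [← Real.exp_add]
    exact Real.exp_le_exp.2 (by linarith)
  have hfac : (0 : ℝ) < ((∑ i, t.2.2 i).factorial : ℝ) := by exact_mod_cast Nat.factorial_pos _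
  unfold gTerm
  rw [div_le_iff₀ (by positivity), mul_comm (Real.exp C), mul_assoc, div_mul_eq_mul_div,
    le_div_iff₀ (by positivity)]
  refine mul_le_mul_of_nonneg_left ?_ (by positivity)
  calc _ ≤ _ := mul_le_mul_of_nonneg_left h3 hfac.le
    _ = _ := by ring

theorem gSubmodule_mono (n : ℕ) (Φ : WeightFamily) :
    Monotone fun ν => gSubmodule n (Φ.psiStar ν) :=
  monotone_nat_of_le_succ (gSubmodule_le_succ n Φ)

/-- The union `G(Ψ*) = ⋃_ν G(ψ_ν*)` as a space of functions on `ℝⁿ`. -/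
def gUnion (n : ℕ) (Φ : WeightFamily) : Submodule ℂ (EuclideanSpace ℝ (Fin n) → ℂ) where
  carrier := {f | ∃ ν, f ∈ gSubmodule n (Φ.psiStar ν)}
  zero_mem' := ⟨0, Submodule.zero_mem _⟩
  add_mem' := by
    rintro f g ⟨ν, hf⟩ ⟨μ, hg⟩
    exact ⟨max ν μ, Submodule.add_mem _ (gSubmodule_mono n Φ (le_max_left ν μ) hf)
      (gSubmodule_mono n Φ (le_max_right ν μ) hg)⟩
  smul_mem' := by
    rintro c f ⟨ν, hf⟩
    exact ⟨ν, Submodule.smul_mem _ c hf⟩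

/-- `G(Ψ*)` as a type; it carries the inductive limit topology of the spaces `G(ψ_ν*)`. -/
def GSpace (n : ℕ) (Φ : WeightFamily) : Type := ↥(gUnion n Φ)

instance (n : ℕ) (Φ : WeightFamily) : AddCommGroup (GSpace n Φ) :=
  inferInstanceAs (AddCommGroup ↥(gUnion n Φ))

instance (n : ℕ) (Φ : WeightFamily) : Module ℂ (GSpace n Φ) :=
  inferInstanceAs (Module ℂ ↥(gUnion n Φ))

instance (n : ℕ) (Φ : WeightFamily) :
    CoeFun (GSpace n Φ) (fun _ => EuclideanSpace ℝ (Fin n) → ℂ) := ⟨fun f => f.1⟩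

/-- The inclusion `G(ψ_ν*) → G(Ψ*)`. -/
def gIncl (n : ℕ) (Φ : WeightFamily) (ν : ℕ) : GStep n (Φ.psiStar ν) →ₗ[ℂ] GSpace n Φ :=
  Submodule.inclusion (p := gSubmodule n (Φ.psiStar ν)) (p' := gUnion n Φ) fun _ hf => ⟨ν, hf⟩

instance (n : ℕ) (Φ : WeightFamily) : TopologicalSpace (GSpace n Φ) :=
  indLimTopology (gIncl n Φ)

/-! ### The Fourier transform -/

/-- The function `ξ ↦ f(ξ) e^{-i⟨x, ξ⟩}` on `ℝⁿ`. -/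
def fourierIntegrand {n : ℕ} (f : EuclideanSpace ℂ (Fin n) → ℂ) (x : EuclideanSpace ℝ (Fin n)) :
    EuclideanSpace ℝ (Fin n) → ℂ :=
  fun ξ => f (realToComplex ξ) * Complex.exp (-Complex.I * ((∑ j, x j * ξ j : ℝ) : ℂ))

/-- The Fourier transform `f^(x) = ∫_{ℝⁿ} f(ξ) e^{-i⟨x, ξ⟩} dξ`. -/
def fourierHat {n : ℕ} (f : EuclideanSpace ℂ (Fin n) → ℂ) (x : EuclideanSpace ℝ (Fin n)) : ℂ :=
  ∫ ξ, fourierIntegrand f x ξ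

end

noncomputable section

section IndLim

variable {ι : Type} {X : ι → Type} [∀ i, AddCommGroup (X i)] [∀ i, Module ℂ (X i)]
    [∀ i, TopologicalSpace (X i)] {V : Type} [AddCommGroup V] [Module ℂ V]
    (j : ∀ i, X i →ₗ[ℂ] V)

theorem indLim_isTopologicalAddGroup :
    @IsTopologicalAddGroup V (indLimTopology j) _ :=
  topologicalAddGroup_sInf fun _ ht => ht.1

theorem indLim_continuousSMul : @ContinuousSMul ℂ V _ _ (indLimTopology j) :=
  continuousSMul_sInf fun _ ht => ht.2.1

theorem indLim_locallyConvexSpace :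
    @LocallyConvexSpace ℝ V _ _ _ (Module.complexToReal V) (indLimTopology j) :=
  LocallyConvexSpace.sInf fun _ ht => ht.2.2.1

theorem continuous_indLim_incl (i : ι) : @Continuous (X i) V _ (indLimTopology j) (j i) :=
  continuous_sInf_rng.2 fun _ ht => ht.2.2.2 i

/-- The universal property of the locally convex inductive limit. -/
theorem continuous_of_indLim {W : Type} [AddCommGroup W] [Module ℂ W] [t : TopologicalSpace W]
    (h1 : IsTopologicalAddGroup W) (h2 : ContinuousSMul ℂ W)
    (h3 : @LocallyConvexSpace ℝ W _ _ _ (Module.complexToReal W) t)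
    (L : V →ₗ[ℂ] W) (hL : ∀ i, Continuous fun x => L (j i x)) :
    @Continuous V W (indLimTopology j) t L := by
  rw [continuous_iff_le_induced]
  refine sInf_le ⟨topologicalAddGroup_induced L, continuousSMul_induced L, ?_, fun i => ?_⟩
  · exact LocallyConvexSpace.induced (L.restrictScalars ℝ)
  · exact continuous_induced_rng.2 (hL i)

end IndLim

theorem withSeminorms_eNorm (n : ℕ) (φ : ℝ → ℝ) : WithSeminorms (eNorm n φ) := ⟨rfl⟩

theorem withSeminorms_gNorm (n : ℕ) (w : ℝ → ℝ) : WithSeminorms (gNorm n w) := ⟨rfl⟩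

theorem eTerm_le_eNorm {n : ℕ} {φ : ℝ → ℝ} (k : ℕ) (f : EStep n φ)
    (z : EuclideanSpace ℂ (Fin n)) : eTerm φ k f.1 z ≤ eNorm n φ k f :=
  le_ciSup (f.2.2 k) z

theorem gTerm_le_gNorm {n : ℕ} {w : ℝ → ℝ} (m : ℕ) (f : GStep n w) (t : GIndex n m) :
    gTerm w f.1 t ≤ gNorm n w m f :=
  le_ciSup (f.2.2 m) t

theorem eNorm_le {n : ℕ} {φ : ℝ → ℝ} {k : ℕ} {f : EStep n φ} {C : ℝ}
    (h : ∀ z, eTerm φ k f.1 z ≤ C) : eNorm n φ k f ≤ C :=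
  ciSup_le h

theorem gNorm_le {n : ℕ} {w : ℝ → ℝ} {m : ℕ} {f : GStep n w} {C : ℝ}
    (h : ∀ t : GIndex n m, gTerm w f.1 t ≤ C) : gNorm n w m f ≤ C :=
  have : Nonempty (GIndex n m) := ⟨(0, ⟨0, by simp⟩, 0)⟩
  ciSup_le h

theorem continuous_of_seminorm_le {E F : Type} [AddCommGroup E] [Module ℂ E] [TopologicalSpace E]
    [AddCommGroup F] [Module ℂ F] [TopologicalSpace F] {p : ℕ → Seminorm ℂ E}
    {q : ℕ → Seminorm ℂ F} (hp : WithSeminorms p) (hq : WithSeminorms q) (L : E →ₗ[ℂ] F)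
    (h : ∀ m, ∃ k, ∃ C : ℝ, 0 ≤ C ∧ ∀ f, q m (L f) ≤ C * p k f) : Continuous L := by
  refine WithSeminorms.continuous_of_isBounded hp hq L fun m => ?_
  obtain ⟨k, C, hC, hk⟩ := h m
  refine ⟨{k}, ⟨C, hC⟩, fun f => ?_⟩
  simpa using! hk f

/-- The isometric inclusion of `ℝⁿ` into `ℂⁿ`. -/
def realToComplexₗᵢ (n : ℕ) : EuclideanSpace ℝ (Fin n) →ₗᵢ[ℝ] EuclideanSpace ℂ (Fin n) where
  toFun := realToComplex
  map_add' x y := by ext i; simp [realToComplex]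
  map_smul' c x := by ext i; simp [realToComplex]
  norm_map' x := by simp [realToComplex, EuclideanSpace.norm_eq]

theorem realToComplex_add {n : ℕ} (x y : EuclideanSpace ℝ (Fin n)) :
    realToComplex (x + y) = realToComplex x + realToComplex y := (realToComplexₗᵢ n).map_add x y

theorem realToComplex_smul {n : ℕ} (c : ℝ) (x : EuclideanSpace ℝ (Fin n)) :
    realToComplex (c • x) = (c : ℂ) • realToComplex x := by
  ext i; simp [realToComplex]

theorem norm_realToComplex {n : ℕ} (x : EuclideanSpace ℝ (Fin n)) :
    ‖realToComplex x‖ = ‖x‖ := (realToComplexₗᵢ n).norm_map x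

theorem continuous_realToComplex {n : ℕ} : Continuous (realToComplex (n := n)) :=
  (realToComplexₗᵢ n).continuous

/-- The vector of real parts. -/
def reVec {n : ℕ} (z : EuclideanSpace ℂ (Fin n)) : EuclideanSpace ℝ (Fin n) :=
  WithLp.toLp 2 (fun j => (z j).re)

theorem reVec_add_imVec {n : ℕ} (z : EuclideanSpace ℂ (Fin n)) :
    z = realToComplex (reVec z) + Complex.I • realToComplex (imVec z) := by
  ext i
  simp only [realToComplex, reVec, imVec, PiLp.add_apply, PiLp.smul_apply, smul_eq_mul]
  rw [mul_comm]; exact (Complex.re_add_im _).symm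

theorem imVec_realToComplex_add {n : ℕ} (x : EuclideanSpace ℝ (Fin n)) (w : ℂ)
    (u : EuclideanSpace ℝ (Fin n)) :
    imVec (realToComplex x + w • realToComplex u) = w.im • u := by
  ext i; simp [imVec, realToComplex]

theorem norm_imVec_le {n : ℕ} (z : EuclideanSpace ℂ (Fin n)) : ‖imVec z‖ ≤ ‖z‖ := by
  simp only [EuclideanSpace.norm_eq, imVec]
  gcongr
  exact Complex.abs_im_le_norm _

theorem norm_reVec_le {n : ℕ} (z : EuclideanSpace ℂ (Fin n)) : ‖reVec z‖ ≤ ‖z‖ := by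
  simp only [EuclideanSpace.norm_eq, reVec]
  gcongr
  exact Complex.abs_re_le_norm _

/-- The bilinear pairing `z ↦ ⟨x, z⟩ = ∑ x_j z_j` for real `x`. -/
def cpair {n : ℕ} (x : EuclideanSpace ℝ (Fin n)) : EuclideanSpace ℂ (Fin n) →L[ℂ] ℂ :=
  innerSL ℂ (realToComplex x)

theorem cpair_apply {n : ℕ} (x : EuclideanSpace ℝ (Fin n)) (z : EuclideanSpace ℂ (Fin n)) :
    cpair x z = ∑ j, (x j : ℂ) * z j := by
  simp [cpair, realToComplex, PiLp.inner_apply, mul_comm]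

theorem cpair_realToComplex {n : ℕ} (x y : EuclideanSpace ℝ (Fin n)) :
    cpair x (realToComplex y) = ((∑ j, x j * y j : ℝ) : ℂ) := by
  simp [cpair_apply, realToComplex]

theorem real_inner_eq_sum {n : ℕ} (x y : EuclideanSpace ℝ (Fin n)) :
    inner ℝ x y = ∑ j, x j * y j := by
  simp [PiLp.inner_apply, mul_comm]

theorem norm_cpair_le {n : ℕ} (x : EuclideanSpace ℝ (Fin n)) : ‖cpair x‖ ≤ ‖x‖ := by
  simp [cpair, norm_realToComplex]

theorem im_cpair {n : ℕ} (x : EuclideanSpace ℝ (Fin n)) (z : EuclideanSpace ℂ (Fin n)) :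
    (cpair x z).im = inner ℝ x (imVec z) := by
  simp [cpair_apply, real_inner_eq_sum, imVec]

theorem norm_cexp_neg_I_cpair {n : ℕ} (x : EuclideanSpace ℝ (Fin n))
    (z : EuclideanSpace ℂ (Fin n)) :
    ‖Complex.exp (-Complex.I * cpair x z)‖ = Real.exp (inner ℝ x (imVec z)) := by
  rw [Complex.norm_exp, ← im_cpair]; simp

theorem norm_cexp_I_cpair {n : ℕ} (x : EuclideanSpace ℝ (Fin n))
    (z : EuclideanSpace ℂ (Fin n)) :
    ‖Complex.exp (Complex.I * cpair x z)‖ = Real.exp (-inner ℝ x (imVec z)) := by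
  rw [Complex.norm_exp, ← im_cpair]; simp

/-- The decay `(1 + ‖x‖)^{-(n+1)}`, an integrable majorant on `ℝⁿ`. -/
def japDecay (n : ℕ) (x : EuclideanSpace ℝ (Fin n)) : ℝ := ((1 + ‖x‖) ^ (n + 1))⁻¹

theorem japDecay_pos {n : ℕ} (x : EuclideanSpace ℝ (Fin n)) : 0 < japDecay n x := by
  unfold japDecay; positivity

theorem integrable_japDecay (n : ℕ) : MeasureTheory.Integrable (japDecay n) := by
  have h := integrable_one_add_norm (E := EuclideanSpace ℝ (Fin n))
    (μ := MeasureTheory.volume) (r := ((n + 1 : ℕ) : ℝ)) (by simp)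
  refine h.congr (Filter.Eventually.of_forall fun x => ?_)
  simp only [japDecay]
  rw [Real.rpow_neg (by positivity), Real.rpow_natCast]

theorem frequently_nhdsNE_zero_of_real {p : ℂ → Prop} (h : ∀ s : ℝ, p s) :
    ∃ᶠ w in nhdsWithin (0 : ℂ) {0}ᶜ, p w := by
  have ht : Filter.Tendsto (fun s : ℝ => (s : ℂ)) (nhdsWithin 0 {0}ᶜ)
      (nhdsWithin (0 : ℂ) {0}ᶜ) := by
    refine tendsto_nhdsWithin_iff.2 ⟨?_, ?_⟩
    · exact (Complex.continuous_ofReal.tendsto' 0 0 (by simp)).mono_left nhdsWithin_le_nhds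
    · filter_upwards [self_mem_nhdsWithin] with s hs using by simpa using hs
  exact ht.frequently (Filter.Frequently.of_forall h)

open MeasureTheory in
theorem integral_realToComplex_add_eq {n : ℕ} {g : EuclideanSpace ℂ (Fin n) → ℂ}
    (hg : Differentiable ℂ g)
    (hb : ∀ R : ℝ, ∃ C, ∀ z, ‖imVec z‖ ≤ R → ‖g z‖ * (1 + ‖z‖) ^ (n + 1) ≤ C)
    (u : EuclideanSpace ℝ (Fin n)) (w : ℂ) :
    ∫ ξ, g (realToComplex ξ + w • realToComplex u) = ∫ ξ, g (realToComplex ξ) := by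
  have hline : ∀ ξ, Differentiable ℂ
      fun w : ℂ => g (realToComplex ξ + w • realToComplex u) := fun ξ =>
    hg.comp ((differentiable_const _).add (differentiable_id.smul_const _))
  have hcont : ∀ w : ℂ, Continuous fun ξ => g (realToComplex ξ + w • realToComplex u) := fun w =>
    hg.continuous.comp (continuous_realToComplex.add continuous_const)
  have hbound : ∀ ρ : ℝ, ∃ K, ∀ w : ℂ, ‖w‖ ≤ ρ → ∀ ξ,
      ‖g (realToComplex ξ + w • realToComplex u)‖ ≤ K * japDecay n ξ := by
    intro ρ
    obtain ⟨C, hC⟩ := hb (ρ * ‖u‖)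
    refine ⟨C * (1 + ρ * ‖u‖) ^ (n + 1), fun w hw ξ => ?_⟩
    have hρ : 0 ≤ ρ := (norm_nonneg w).trans hw
    set z := realToComplex ξ + w • realToComplex u with hz
    have h1 := hC z (by
      rw [hz, imVec_realToComplex_add, norm_smul]
      exact mul_le_mul_of_nonneg_right ((Complex.abs_im_le_norm w).trans hw) (norm_nonneg _))
    have h2 : ‖ξ‖ ≤ ‖z‖ + ρ * ‖u‖ := by
      have h3 : realToComplex ξ = z - w • realToComplex u := by rw [hz]; abel
      rw [← norm_realToComplex ξ, h3]
      refine (norm_sub_le _ _).trans ?_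
      rw [norm_smul, norm_realToComplex]
      gcongr
    have h4 : 1 + ‖ξ‖ ≤ (1 + ‖z‖) * (1 + ρ * ‖u‖) := by
      nlinarith [norm_nonneg z, mul_nonneg (norm_nonneg z) (mul_nonneg hρ (norm_nonneg u))]
    rw [japDecay, ← div_eq_mul_inv, le_div_iff₀ (by positivity)]
    calc _ ≤ ‖g z‖ * ((1 + ‖z‖) * (1 + ρ * ‖u‖)) ^ (n + 1) := by gcongr
      _ = (‖g z‖ * (1 + ‖z‖) ^ (n + 1)) * (1 + ρ * ‖u‖) ^ (n + 1) := by rw [mul_pow]; ring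
      _ ≤ _ := by gcongr
  set H : ℂ → ℂ := fun w => ∫ ξ, g (realToComplex ξ + w • realToComplex u) with hH
  have hder : ∀ ξ w, HasDerivAt (fun w : ℂ => g (realToComplex ξ + w • realToComplex u))
      (fderiv ℂ g (realToComplex ξ + w • realToComplex u) (realToComplex u)) w := by
    intro ξ w
    have h1 : HasDerivAt (fun w : ℂ => realToComplex ξ + w • realToComplex u)
        (realToComplex u) w := by
      simpa using ((hasDerivAt_id w).smul_const (realToComplex u)).const_add (realToComplex ξ)
    exact (hg _).hasFDerivAt.comp_hasDerivAt w h1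
  have hdiff : Differentiable ℂ H := by
    intro w₀
    obtain ⟨K, hK⟩ := hbound (‖w₀‖ + 2)
    refine (hasDerivAt_integral_of_dominated_loc_of_deriv_le (μ := volume)
      (bound := fun ξ => K * japDecay n ξ)
      (F' := fun w ξ => fderiv ℂ g (realToComplex ξ + w • realToComplex u) (realToComplex u))
      (Metric.ball_mem_nhds w₀ one_pos)
      (Filter.Eventually.of_forall fun w => (hcont w).aestronglyMeasurable) ?_ ?_ ?_ ?_ ?_).2.differentiableAt
    · exact ((integrable_japDecay n).const_mul K).mono' (hcont w₀).aestronglyMeasurable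
        (Filter.Eventually.of_forall fun ξ => hK w₀ (by linarith) ξ)
    · exact ((measurable_fderiv_apply_const ℂ g (realToComplex u)).comp
        (continuous_realToComplex.add continuous_const).measurable).aestronglyMeasurable
    · refine Filter.Eventually.of_forall fun ξ w hw => ?_
      have hw' : ‖w - w₀‖ < 1 := by simpa [dist_eq_norm] using hw
      rw [← (hder ξ w).deriv]
      have := Complex.norm_deriv_le_of_forall_mem_sphere_norm_le (c := w) (R := 1)
        (C := K * japDecay n ξ) one_pos (hline ξ).diffContOnCl fun v hv => hK v ?_ ξ
      · simpa using this
      · have hv' : ‖v - w‖ = 1 := by simpa [dist_eq_norm] using hv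
        have : v = (v - w) + (w - w₀) + w₀ := by ring
        calc ‖v‖ = ‖(v - w) + (w - w₀) + w₀‖ := by rw [← this]
          _ ≤ ‖v - w‖ + ‖w - w₀‖ + ‖w₀‖ := norm_add₃_le
          _ ≤ _ := by linarith
    · exact (integrable_japDecay n).const_mul K
    · exact Filter.Eventually.of_forall fun ξ w _ => hder ξ w
  have hreal : ∀ s : ℝ, H s = H 0 := by
    intro s
    have h1 : H s = ∫ ξ, (fun ξ => g (realToComplex ξ)) (ξ + s • u) := by
      simp only [hH, realToComplex_add, realToComplex_smul]
    rw [h1, integral_add_right_eq_self (μ := volume) (fun ξ => g (realToComplex ξ)) (s • u)]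
    simp [hH]
  have hfreq : ∃ᶠ w in nhdsWithin (0 : ℂ) {0}ᶜ, H w = H 0 :=
    frequently_nhdsNE_zero_of_real hreal
  have hHc : H = fun _ => H 0 :=
    AnalyticOnNhd.eq_of_frequently_eq (z₀ := 0) (fun z _ => hdiff.analyticAt z)
      (fun z _ => analyticAt_const) hfreq
  have h0 : H 0 = ∫ ξ, g (realToComplex ξ) := by simp [hH]
  rw [← h0]
  exact congrFun hHc w

/-- Entire functions that agree on `ℝⁿ` are equal. -/
theorem eq_of_eq_on_real {n : ℕ} {f g : EuclideanSpace ℂ (Fin n) → ℂ}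
    (hf : Differentiable ℂ f) (hg : Differentiable ℂ g)
    (h : ∀ x, f (realToComplex x) = g (realToComplex x)) : f = g := by
  funext z
  have hline : Differentiable ℂ
      fun w : ℂ => realToComplex (reVec z) + w • realToComplex (imVec z) :=
    (differentiable_const _).add (differentiable_id.smul_const _)
  have hfreq : ∃ᶠ w in nhdsWithin (0 : ℂ) {0}ᶜ,
      f (realToComplex (reVec z) + w • realToComplex (imVec z)) =
        g (realToComplex (reVec z) + w • realToComplex (imVec z)) := by
    refine frequently_nhdsNE_zero_of_real fun s => ?_
    rw [← realToComplex_smul, ← realToComplex_add, h]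
  have := AnalyticOnNhd.eq_of_frequently_eq (z₀ := 0)
    (fun w _ => (hf.comp hline).analyticAt w) (fun w _ => (hg.comp hline).analyticAt w) hfreq
  have h1 := congrFun this Complex.I
  simp only [Function.comp, ← reVec_add_imVec] at h1
  exact h1

theorem fourierIntegrand_apply {n : ℕ} (f : EuclideanSpace ℂ (Fin n) → ℂ)
    (x ξ : EuclideanSpace ℝ (Fin n)) : fourierIntegrand f x ξ =
      f (realToComplex ξ) * Complex.exp (-Complex.I * cpair x (realToComplex ξ)) := by
  rw [cpair_realToComplex]; rfl

theorem norm_mul_pow_le_of_eTerm_le {n : ℕ} {φ : ℝ → ℝ} {k : ℕ}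
    {f : EuclideanSpace ℂ (Fin n) → ℂ} {P : ℝ} {z : EuclideanSpace ℂ (Fin n)} :
    eTerm φ k f z ≤ P ↔ ‖f z‖ * (1 + ‖z‖) ^ k ≤ P * Real.exp (φ ‖imVec z‖) := by
  rw [eTerm, div_le_iff₀ (Real.exp_pos _)]

theorem reVec_realToComplex_add {n : ℕ} (x : EuclideanSpace ℝ (Fin n)) (w : ℂ)
    (u : EuclideanSpace ℝ (Fin n)) :
    reVec (realToComplex x + w • realToComplex u) = x + w.re • u := by
  ext i; simp [reVec, realToComplex]

theorem imVec_realToComplex {n : ℕ} (x : EuclideanSpace ℝ (Fin n)) :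
    imVec (realToComplex x) = 0 := by
  ext i; simp [imVec, realToComplex]

theorem norm_le_japDecay {n : ℕ} {a P r : ℝ} {ξ : EuclideanSpace ℝ (Fin n)} (ha : 0 ≤ a)
    (hr : ‖ξ‖ ≤ r) (h : a * (1 + r) ^ (n + 1) ≤ P) : a ≤ P * japDecay n ξ := by
  rw [japDecay, ← div_eq_mul_inv, le_div_iff₀ (by positivity)]
  refine le_trans ?_ h
  gcongr

theorem norm_restrict_le_japDecay {n : ℕ} {φ : ℝ → ℝ} {f : EuclideanSpace ℂ (Fin n) → ℂ} {P : ℝ}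
    (hP : ∀ z, eTerm φ (n + 1) f z ≤ P) (ξ : EuclideanSpace ℝ (Fin n)) :
    ‖f (realToComplex ξ)‖ ≤ P * Real.exp (φ 0) * japDecay n ξ := by
  have h := norm_mul_pow_le_of_eTerm_le.1 (hP (realToComplex ξ))
  rw [imVec_realToComplex, norm_zero, norm_realToComplex] at h
  exact norm_le_japDecay (norm_nonneg _) le_rfl h

open MeasureTheory in
theorem integrable_restrict {n : ℕ} {φ : ℝ → ℝ} {f : EuclideanSpace ℂ (Fin n) → ℂ}
    (hf : f ∈ eSubmodule n φ) : Integrable fun ξ => f (realToComplex ξ) := by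
  obtain ⟨P, hP⟩ := hf.2 (n + 1)
  exact ((integrable_japDecay n).const_mul (P * Real.exp (φ 0))).mono'
    (hf.1.continuous.comp continuous_realToComplex).aestronglyMeasurable
    (Filter.Eventually.of_forall fun ξ => norm_restrict_le_japDecay (fun z => hP ⟨z, rfl⟩) ξ)

open MeasureTheory in
theorem integrable_fourierIntegrand {n : ℕ} {φ : ℝ → ℝ} {f : EuclideanSpace ℂ (Fin n) → ℂ}
    (hf : f ∈ eSubmodule n φ) (x : EuclideanSpace ℝ (Fin n)) :
    Integrable (fourierIntegrand f x) := by
  refine (integrable_restrict hf).mono ?_ (Filter.Eventually.of_forall fun ξ => ?_)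
  · have h1 : Continuous (fourierIntegrand f x) := by
      have : fourierIntegrand f x = fun ξ => f (realToComplex ξ) *
        Complex.exp (-Complex.I * cpair x (realToComplex ξ)) :=
        funext fun ξ => fourierIntegrand_apply f x ξ
      rw [this]
      have h2 := hf.1.continuous.comp continuous_realToComplex
      have h3 := (cpair x).continuous.comp continuous_realToComplex
      exact h2.mul (Complex.continuous_exp.comp (continuous_const.mul h3))
    exact h1.aestronglyMeasurable
  · rw [fourierIntegrand_apply, norm_mul, norm_cexp_neg_I_cpair, imVec_realToComplex]
    simp

open MeasureTheory in
theorem norm_fourierHat_le {n : ℕ} {φ : ℝ → ℝ} (hφ : MonotoneOn φ (Set.Ici 0))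
    {f : EuclideanSpace ℂ (Fin n) → ℂ} (hf : Differentiable ℂ f) {P : ℝ}
    (hP : ∀ z, eTerm φ (n + 1) f z ≤ P) (x : EuclideanSpace ℝ (Fin n)) {t : ℝ} (ht : 0 ≤ t) :
    ‖fourierHat f x‖ ≤ P * Real.exp (φ t - t * ‖x‖) * ∫ ξ, japDecay n ξ := by
  have hP0 : 0 ≤ P := (eTerm_nonneg φ (n + 1) f 0).trans (hP 0)
  set g : EuclideanSpace ℂ (Fin n) → ℂ := fun z =>
    f z * Complex.exp (-Complex.I * cpair x z) with hg
  have hgd : Differentiable ℂ g :=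
    hf.mul (((cpair x).differentiable.const_mul _).cexp)
  have hgb : ∀ z, ∀ R : ℝ, ‖imVec z‖ ≤ R →
      ‖g z‖ * (1 + ‖z‖) ^ (n + 1) ≤ P * Real.exp (φ R) * Real.exp (inner ℝ x (imVec z)) := by
    intro z R hR
    have h := norm_mul_pow_le_of_eTerm_le.1 (hP z)
    have h2 : φ ‖imVec z‖ ≤ φ R := hφ (norm_nonneg (imVec z)) ((norm_nonneg _).trans hR) hR
    simp only [hg, norm_mul, norm_cexp_neg_I_cpair]
    calc _ = (‖f z‖ * (1 + ‖z‖) ^ (n + 1)) * Real.exp (inner ℝ x (imVec z)) := by ring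
      _ ≤ P * Real.exp (φ ‖imVec z‖) * Real.exp (inner ℝ x (imVec z)) := by gcongr
      _ ≤ _ := by gcongr
  set u : EuclideanSpace ℝ (Fin n) := -(‖x‖⁻¹ • x) with hu
  have hu1 : ‖u‖ ≤ 1 := by
    rw [hu, norm_neg, norm_smul, norm_inv, norm_norm]
    exact inv_mul_le_one
  have hxu : inner ℝ x u = -‖x‖ := by
    rw [hu, inner_neg_right, inner_smul_right, real_inner_self_eq_norm_sq]
    rcases eq_or_ne ‖x‖ 0 with h | h
    · simp [h]
    · field_simp
  have hshift := integral_realToComplex_add_eq hgd (fun R => ⟨P * Real.exp (φ R) *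
    Real.exp (‖x‖ * R), fun z hz => (hgb z R hz).trans (by
      gcongr
      exact (real_inner_le_norm _ _).trans (by gcongr))⟩) u ((t : ℂ) * Complex.I)
  have h0 : fourierHat f x = ∫ ξ, g (realToComplex ξ) :=
    integral_congr_ae (Filter.Eventually.of_forall fun ξ => fourierIntegrand_apply f x ξ)
  rw [h0, ← hshift, ← integral_const_mul]
  refine norm_integral_le_of_norm_le ((integrable_japDecay n).const_mul _)
    (Filter.Eventually.of_forall fun ξ => ?_)
  set z := realToComplex ξ + ((t : ℂ) * Complex.I) • realToComplex u with hz
  have him : imVec z = t • u := by rw [hz, imVec_realToComplex_add]; simp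
  have hre : reVec z = ξ := by rw [hz, reVec_realToComplex_add]; simp
  refine norm_le_japDecay (norm_nonneg _) (r := ‖z‖) (hre ▸ norm_reVec_le z) ?_
  refine (hgb z t ?_).trans (le_of_eq ?_)
  · rw [him, norm_smul, Real.norm_of_nonneg ht]
    exact mul_le_of_le_one_right ht hu1
  · rw [him, inner_smul_right, hxu, mul_assoc, ← Real.exp_add]
    congr 2; ring

theorem eTerm_mul_le {n : ℕ} {φ : ℝ → ℝ} {k m : ℕ} {f g : EuclideanSpace ℂ (Fin n) → ℂ}
    {z : EuclideanSpace ℂ (Fin n)} (h : ‖g z‖ ≤ (1 + ‖z‖) ^ m * ‖f z‖) :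
    eTerm φ k g z ≤ eTerm φ (k + m) f z := by
  unfold eTerm
  refine div_le_div_of_nonneg_right ?_ (Real.exp_pos _).le
  calc ‖g z‖ * (1 + ‖z‖) ^ k ≤ ((1 + ‖z‖) ^ m * ‖f z‖) * (1 + ‖z‖) ^ k := by gcongr
    _ = _ := by rw [pow_add]; ring

theorem mem_eSubmodule_of_norm_le {n : ℕ} {φ : ℝ → ℝ} {m : ℕ}
    {f g : EuclideanSpace ℂ (Fin n) → ℂ} (hf : f ∈ eSubmodule n φ) (hg : Differentiable ℂ g)
    (h : ∀ z, ‖g z‖ ≤ (1 + ‖z‖) ^ m * ‖f z‖) : g ∈ eSubmodule n φ := by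
  refine ⟨hg, fun k => ?_⟩
  obtain ⟨A, hA⟩ := hf.2 (k + m)
  refine ⟨A, ?_⟩
  rintro _ ⟨z, rfl⟩
  exact (eTerm_mul_le (h z)).trans (hA ⟨z, rfl⟩)

theorem differentiable_coord {n : ℕ} (j : Fin n) :
    Differentiable ℂ fun z : EuclideanSpace ℂ (Fin n) => z j :=
  (EuclideanSpace.proj (𝕜 := ℂ) j).differentiable

theorem mul_coord_mem {n : ℕ} {φ : ℝ → ℝ} {f : EuclideanSpace ℂ (Fin n) → ℂ}
    (hf : f ∈ eSubmodule n φ) (j : Fin n) :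
    (fun z => -Complex.I * z j * f z) ∈ eSubmodule n φ ∧
      ∀ z, ‖-Complex.I * z j * f z‖ ≤ (1 + ‖z‖) ^ 1 * ‖f z‖ := by
  have h : ∀ z, ‖-Complex.I * z j * f z‖ ≤ (1 + ‖z‖) ^ 1 * ‖f z‖ := by
    intro z
    have := PiLp.norm_apply_le z j
    simp only [norm_mul, norm_neg, Complex.norm_I, one_mul, pow_one]
    gcongr
    linarith
  exact ⟨mem_eSubmodule_of_norm_le hf (((differentiable_coord j).const_mul _).mul hf.1) h, h⟩

open Real FourierTransform in
theorem fourierHat_eq_fourier {n : ℕ} (f : EuclideanSpace ℂ (Fin n) → ℂ)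
    (x : EuclideanSpace ℝ (Fin n)) :
    fourierHat f x = 𝓕 (fun ξ => f (realToComplex ξ)) ((2 * π)⁻¹ • x) := by
  rw [fourier_eq', fourierHat]
  congr 1
  funext ξ
  rw [fourierIntegrand, smul_eq_mul, mul_comm]
  congr 2
  rw [inner_smul_right, real_inner_eq_sum]
  have hs : ∑ j, ξ j * x j = ∑ j, x j * ξ j := Finset.sum_congr rfl fun j _ => mul_comm _ _
  have : -2 * π * ((2 * π)⁻¹ * ∑ j, ξ j * x j) = -∑ j, x j * ξ j := by
    rw [hs]; field_simp
  rw [this]; push_cast; ring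

open MeasureTheory in
theorem integrable_pow_mul_restrict {n : ℕ} {φ : ℝ → ℝ} {f : EuclideanSpace ℂ (Fin n) → ℂ}
    (hf : f ∈ eSubmodule n φ) (k : ℕ) :
    Integrable fun ξ => ‖ξ‖ ^ k * ‖f (realToComplex ξ)‖ := by
  obtain ⟨P, hP⟩ := hf.2 (n + 1 + k)
  refine ((integrable_japDecay n).const_mul (P * Real.exp (φ 0))).mono'
    ((continuous_norm.pow k).mul
      (hf.1.continuous.comp continuous_realToComplex).norm).aestronglyMeasurable
    (Filter.Eventually.of_forall fun ξ => ?_)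
  have h := norm_mul_pow_le_of_eTerm_le.1 (hP ⟨realToComplex ξ, rfl⟩)
  rw [imVec_realToComplex, norm_zero, norm_realToComplex] at h
  rw [Real.norm_of_nonneg (by positivity)]
  refine norm_le_japDecay (by positivity) le_rfl (le_trans ?_ h)
  rw [pow_add (1 + ‖ξ‖) (n + 1) k]
  calc _ = ‖f (realToComplex ξ)‖ * ((1 + ‖ξ‖) ^ (n + 1) * ‖ξ‖ ^ k) := by ring
    _ ≤ ‖f (realToComplex ξ)‖ * ((1 + ‖ξ‖) ^ (n + 1) * (1 + ‖ξ‖) ^ k) := by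
      have : ‖ξ‖ ≤ 1 + ‖ξ‖ := by linarith
      gcongr

open Real FourierTransform in
theorem contDiff_fourierHat {n : ℕ} {φ : ℝ → ℝ} {f : EuclideanSpace ℂ (Fin n) → ℂ}
    (hf : f ∈ eSubmodule n φ) : ContDiff ℝ ∞ (fourierHat f) := by
  have h := Real.contDiff_fourier (N := ⊤) (f := fun ξ => f (realToComplex ξ))
    fun k _ => integrable_pow_mul_restrict hf k
  have h2 : fourierHat f = fun x => 𝓕 (fun ξ => f (realToComplex ξ)) ((2 * π)⁻¹ • x) :=
    funext (fourierHat_eq_fourier f)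
  rw [h2]
  exact h.comp (contDiff_const_smul _)

open Real FourierTransform MeasureTheory in
theorem partialDeriv_fourierHat {n : ℕ} {φ : ℝ → ℝ} {f : EuclideanSpace ℂ (Fin n) → ℂ}
    (hf : f ∈ eSubmodule n φ) (j : Fin n) :
    partialDeriv j (fourierHat f) = fourierHat fun z => -Complex.I * z j * f z := by
  funext x
  have h1 := Real.hasFDerivAt_fourier (integrable_restrict hf)
    (by simpa using integrable_pow_mul_restrict hf 1) ((2 * π)⁻¹ • x)
  have h2 : HasFDerivAt (fun x : EuclideanSpace ℝ (Fin n) => (2 * π)⁻¹ • x)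
      ((2 * π)⁻¹ • ContinuousLinearMap.id ℝ _) x :=
    HasFDerivAt.fun_const_smul (hasFDerivAt_id x) _
  have h3 := h1.comp x h2
  have h5 := HasFDerivAt.congr_of_eventuallyEq h3
    (Filter.Eventually.of_forall (fourierHat_eq_fourier f))
  rw [partialDeriv, h5.hasLineDerivAt _ |>.lineDeriv, fourierHat_eq_fourier]
  rw [ContinuousLinearMap.comp_apply, smul_apply,
    ContinuousLinearMap.id_apply, map_smul, fourier_continuousLinearMap_apply]
  · rw [fourier_eq', fourier_eq', ← integral_smul]
    congr 1
    funext ξ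
    rw [VectorFourier.fourierSMulRight_apply]
    have : innerSL ℝ ξ (EuclideanSpace.single j (1 : ℝ)) = ξ j := by
      simp [EuclideanSpace.inner_single_right]
    rw [this]
    have h6 : realToComplex ξ j = (ξ j : ℂ) := rfl
    rw [h6]
    simp only [smul_eq_mul, Complex.real_smul]
    push_cast
    field_simp
  · refine ((integrable_pow_mul_restrict hf 1).const_mul (2 * π * ‖innerSL ℝ (E :=
      EuclideanSpace ℝ (Fin n))‖)).mono'
      (integrable_restrict hf).aestronglyMeasurable.fourierSMulRight
      (Filter.Eventually.of_forall fun ξ => ?_)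
    rw [pow_one, ← mul_assoc]
    exact VectorFourier.norm_fourierSMulRight_le _ _ ξ

theorem multiDeriv_fourierHat {n : ℕ} {φ : ℝ → ℝ} {f : EuclideanSpace ℂ (Fin n) → ℂ}
    (hf : f ∈ eSubmodule n φ) (α : Fin n → ℕ) :
    ∃ g ∈ eSubmodule n φ, multiDeriv α (fourierHat f) = fourierHat g ∧
      ∀ z, ‖g z‖ ≤ (1 + ‖z‖) ^ (∑ i, α i) * ‖f z‖ := by
  have hit : ∀ (j : Fin n) (k : ℕ) (f : EuclideanSpace ℂ (Fin n) → ℂ), f ∈ eSubmodule n φ →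
      ∃ g ∈ eSubmodule n φ, (partialDeriv j)^[k] (fourierHat f) = fourierHat g ∧
      ∀ z, ‖g z‖ ≤ (1 + ‖z‖) ^ k * ‖f z‖ := by
    intro j k
    induction k with
    | zero => exact fun f hf => ⟨f, hf, rfl, fun z => by simp⟩
    | succ k ih =>
      intro f hf
      obtain ⟨h1, h2⟩ := mul_coord_mem hf j
      obtain ⟨g, hg, hg', hgb⟩ := ih _ h1
      refine ⟨g, hg, ?_, fun z => ?_⟩
      · rw [Function.iterate_succ_apply, partialDeriv_fourierHat hf, hg']
      · rw [pow_succ, mul_assoc]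
        refine (hgb z).trans (mul_le_mul_of_nonneg_left ?_ (by positivity))
        simpa using h2 z
  have hl : ∀ l : List (Fin n), ∃ g ∈ eSubmodule n φ,
      l.foldr (fun j g => (partialDeriv j)^[α j] g) (fourierHat f) = fourierHat g ∧
      ∀ z, ‖g z‖ ≤ (1 + ‖z‖) ^ (l.map α).sum * ‖f z‖ := by
    intro l
    induction l with
    | nil => exact ⟨f, hf, rfl, fun z => by simp⟩
    | cons j l ih =>
      obtain ⟨g, hg, hg', hgb⟩ := ih
      obtain ⟨h, hh, hh', hhb⟩ := hit j (α j) g hg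
      refine ⟨h, hh, ?_, fun z => ?_⟩
      · rw [List.foldr_cons, hg', hh']
      · rw [List.map_cons, List.sum_cons, pow_add, mul_assoc]
        exact (hhb z).trans (mul_le_mul_of_nonneg_left (hgb z) (by positivity))
  obtain ⟨g, hg, hg', hgb⟩ := hl (List.finRange n)
  refine ⟨g, hg, hg', fun z => ?_⟩
  rw [Fin.sum_univ_def]
  exact hgb z

theorem abs_prod_pow_le {n : ℕ} (x : EuclideanSpace ℝ (Fin n)) (β : Fin n → ℕ) :
    |∏ i, x i ^ β i| ≤ ‖x‖ ^ ∑ i, β i := by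
  rw [Finset.abs_prod, ← Finset.prod_pow_eq_pow_sum]
  refine Finset.prod_le_prod (fun i _ => abs_nonneg _) fun i _ => ?_
  rw [abs_pow]
  gcongr
  exact PiLp.norm_apply_le x i

/-- A bound by all `B e^{φ(s)} / s^b`, `s ≥ 1`, is a bound by `B e^{-ψ*(b)}`. -/
theorem WeightFamily.le_mul_exp_neg_psiStar (Φ : WeightFamily) (ν b : ℕ) {A B : ℝ} (hA : 0 ≤ A)
    (hB : 0 ≤ B) (h : ∀ s : ℝ, 1 ≤ s → A * s ^ b ≤ B * Real.exp (Φ ν s)) :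
    A ≤ B * Real.exp (-Φ.psiStar ν b) := by
  rcases hA.eq_or_lt with rfl | hA
  · positivity
  have hB : 0 < B := by
    have h1 := h 1 le_rfl
    rw [one_pow, mul_one] at h1
    exact pos_of_mul_pos_left (hA.trans_le h1) (Real.exp_pos _).le
  have h1 : Φ.psiStar ν b ≤ Real.log B - Real.log A := by
    refine ciSup_le fun y => ?_
    have h2 := Real.log_le_log (by positivity) (h (Real.exp y) (Real.one_le_exp y.2))
    rw [Real.log_mul hA.ne' (by positivity), Real.log_mul hB.ne' (Real.exp_ne_zero _),
      Real.log_pow, Real.log_exp, Real.log_exp] at h2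
    linarith
  rw [← Real.log_le_log_iff hA (by positivity), Real.log_mul hB.ne' (Real.exp_ne_zero _),
    Real.log_exp]
  linarith

theorem WeightFamily.exp_neg_psiStar_mul_le (Φ : WeightFamily) (ν b : ℕ) {s : ℝ} (hs : 1 ≤ s) :
    Real.exp (-Φ.psiStar ν b) * s ^ b ≤ Real.exp (Φ ν s) := by
  have h := le_ciSup (Φ.bddAbove_psiStar ν b) ⟨Real.log s, Real.log_nonneg hs⟩
  have h0 : 0 < s := by linarith
  have h1 : (b : ℝ) * Real.log s - Φ ν (Real.exp (Real.log s)) ≤ Φ.psiStar ν b := h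
  rw [Real.exp_log h0] at h1
  rw [← Real.exp_log (pow_pos h0 b), ← Real.exp_add, Real.log_pow]
  exact Real.exp_le_exp.2 (by linarith)

theorem gTerm_fourierHat_le {n m : ℕ} (Φ : WeightFamily) (ν : ℕ)
    {f : EuclideanSpace ℂ (Fin n) → ℂ} (hf : f ∈ eSubmodule n (Φ ν)) {P : ℝ}
    (hP : ∀ z, eTerm (Φ ν) (n + 1 + m) f z ≤ P) (t : GIndex n m) :
    gTerm (Φ.psiStar ν) (fourierHat f) t ≤ (∫ ξ, japDecay n ξ) * P := by
  obtain ⟨x, ⟨α, hα⟩, β⟩ := t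
  obtain ⟨g, hg, hgf, hgb⟩ := multiDeriv_fourierHat hf α
  have hJ : 0 ≤ ∫ ξ, japDecay n ξ :=
    MeasureTheory.integral_nonneg fun ξ => (japDecay_pos ξ).le
  have hP0 : 0 ≤ P := (eTerm_nonneg _ _ f 0).trans (hP 0)
  have hgP : ∀ z, eTerm (Φ ν) (n + 1) g z ≤ P := fun z =>
    (eTerm_mul_le ((hgb z).trans (mul_le_mul_of_nonneg_right
      (pow_le_pow_right₀ (by linarith [norm_nonneg z]) hα) (norm_nonneg _)))).trans (hP z)
  change |∏ i, x i ^ β i| * ‖multiDeriv α (fourierHat f) x‖ /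
    (((∑ i, β i).factorial : ℝ) * Real.exp (-Φ.psiStar ν ((∑ i, β i : ℕ) : ℝ))) ≤ _
  rw [hgf]
  set b := ∑ i, β i with hb
  rw [div_le_iff₀ (by positivity), ← mul_assoc]
  refine Φ.le_mul_exp_neg_psiStar ν b (by positivity) (by positivity) fun s hs => ?_
  have h1 := norm_fourierHat_le (Φ.monotoneOn ν) hg.1 hgP x (t := s) (by linarith)
  have h2 : (s * ‖x‖) ^ b ≤ b.factorial * Real.exp (s * ‖x‖) := by
    have := Real.pow_div_factorial_le_exp (s * ‖x‖) (by positivity) b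
    rw [div_le_iff₀ (by positivity)] at this
    linarith
  calc |∏ i, x i ^ β i| * ‖fourierHat g x‖ * s ^ b
      ≤ ‖x‖ ^ b * (P * Real.exp (Φ ν s - s * ‖x‖) * ∫ ξ, japDecay n ξ) * s ^ b := by
        gcongr
        exact abs_prod_pow_le x β
    _ = (s * ‖x‖) ^ b * (P * Real.exp (Φ ν s - s * ‖x‖) * ∫ ξ, japDecay n ξ) := by
        rw [mul_pow]; ring
    _ ≤ (b.factorial * Real.exp (s * ‖x‖)) *
        (P * Real.exp (Φ ν s - s * ‖x‖) * ∫ ξ, japDecay n ξ) := by gcongr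
    _ = _ := by rw [Real.exp_sub]; field_simp

theorem fourierHat_mem_gSubmodule {n : ℕ} (Φ : WeightFamily) (ν : ℕ)
    {f : EuclideanSpace ℂ (Fin n) → ℂ} (hf : f ∈ eSubmodule n (Φ ν)) :
    fourierHat f ∈ gSubmodule n (Φ.psiStar ν) := by
  refine ⟨contDiff_fourierHat hf, fun m => ?_⟩
  obtain ⟨P, hP⟩ := hf.2 (n + 1 + m)
  refine ⟨(∫ ξ, japDecay n ξ) * P, ?_⟩
  rintro _ ⟨t, rfl⟩
  exact gTerm_fourierHat_le Φ ν hf (fun z => hP ⟨z, rfl⟩) t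

theorem euclidean_norm_le_of_forall_le {𝕜 : Type*} [RCLike 𝕜] {n : ℕ} {z : EuclideanSpace 𝕜 (Fin n)}
    {a : ℝ} (ha : 0 ≤ a) (h : ∀ j, ‖z j‖ ≤ a) : ‖z‖ ≤ n * a := by
  rw [EuclideanSpace.norm_eq, Real.sqrt_le_left (by positivity)]
  calc ∑ j, ‖z j‖ ^ 2 ≤ ∑ _j : Fin n, a ^ 2 := Finset.sum_le_sum fun j _ => by gcongr; exact h j
    _ = n * a ^ 2 := by simp
    _ ≤ (n ^ 2 : ℕ) * a ^ 2 := by gcongr; exact Nat.le_self_pow two_ne_zero n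
    _ = _ := by push_cast; ring

theorem exists_multiindex_norm_pow_le {n : ℕ} (x : EuclideanSpace ℝ (Fin n)) (b : ℕ) :
    ‖x‖ ^ b = 0 ∨ ∃ β : Fin n → ℕ, ∑ i, β i = b ∧
      ‖x‖ ^ b ≤ (n + 1 : ℝ) ^ b * |∏ i, x i ^ β i| := by
  rcases isEmpty_or_nonempty (Fin n) with h | h
  · rcases Nat.eq_zero_or_pos b with rfl | hb
    · exact Or.inr ⟨0, by simp, by simp⟩
    · left
      have : x = 0 := by ext i; exact h.elim i
      simp [this, hb.ne']
  · right
    obtain ⟨j, hj⟩ := Finite.exists_max fun j => ‖x j‖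
    refine ⟨Pi.single j b, by simp, ?_⟩
    have h1 : ∏ i, x i ^ (Pi.single j b : Fin n → ℕ) i = x j ^ b := by
      rw [Finset.prod_eq_single j (fun i _ hi => by simp [hi]) (by simp)]
      simp
    rw [h1, abs_pow, ← mul_pow]
    have h2 := euclidean_norm_le_of_forall_le (norm_nonneg (x j)) hj
    rw [Real.norm_eq_abs] at h2
    gcongr
    linarith [abs_nonneg (x j)]

theorem norm_multiDeriv_mul_le {n m : ℕ} (Φ : WeightFamily) (ν : ℕ)
    {f : EuclideanSpace ℝ (Fin n) → ℂ} {P : ℝ}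
    (hP : ∀ t : GIndex n m, gTerm (Φ.psiStar ν) f t ≤ P) {α : Fin n → ℕ} (hα : ∑ i, α i ≤ m)
    (x : EuclideanSpace ℝ (Fin n)) (b : ℕ) {s : ℝ} (hs : 1 ≤ s) :
    ‖multiDeriv α f x‖ * ‖x‖ ^ b * s ^ b ≤
      P * (n + 1 : ℝ) ^ b * b.factorial * Real.exp (Φ ν s) := by
  have hP0 : 0 ≤ P := (gTerm_nonneg _ f _).trans (hP (x, ⟨α, hα⟩, 0))
  rcases exists_multiindex_norm_pow_le x b with h | ⟨β, rfl, hβ⟩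
  · rw [h]; simp only [mul_zero, zero_mul]; positivity
  set b := ∑ i, β i with hb
  have h1 : |∏ i, x i ^ β i| * ‖multiDeriv α f x‖ /
    ((b.factorial : ℝ) * Real.exp (-Φ.psiStar ν b)) ≤ P := hP (x, ⟨α, hα⟩, β)
  rw [div_le_iff₀ (by positivity)] at h1
  calc ‖multiDeriv α f x‖ * ‖x‖ ^ b * s ^ b
      ≤ ‖multiDeriv α f x‖ * ((n + 1 : ℝ) ^ b * |∏ i, x i ^ β i|) * s ^ b := by gcongr
    _ = (n + 1 : ℝ) ^ b * s ^ b * (|∏ i, x i ^ β i| * ‖multiDeriv α f x‖) := by ring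
    _ ≤ (n + 1 : ℝ) ^ b * s ^ b * (P * (b.factorial * Real.exp (-Φ.psiStar ν b))) := by gcongr
    _ = P * (n + 1 : ℝ) ^ b * b.factorial * (Real.exp (-Φ.psiStar ν b) * s ^ b) := by ring
    _ ≤ _ := by gcongr; exact Φ.exp_neg_psiStar_mul_le ν b hs

/-- The constant relating exponential decay to `japDecay`. -/
def decayConst (n : ℕ) : ℝ := 2 * Real.exp 1 * (n + 1).factorial

theorem decayConst_pos (n : ℕ) : 0 < decayConst n := by unfold decayConst; positivity

theorem exp_neg_norm_le {n : ℕ} (x : EuclideanSpace ℝ (Fin n)) :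
    2 * Real.exp (-‖x‖) ≤ decayConst n * japDecay n x := by
  have h := Real.pow_div_factorial_le_exp (1 + ‖x‖) (by positivity) (n + 1)
  rw [div_le_iff₀ (by positivity), Real.exp_add] at h
  rw [decayConst, japDecay, ← div_eq_mul_inv, le_div_iff₀ (by positivity), Real.exp_neg]
  have := Real.exp_pos ‖x‖
  calc 2 * (Real.exp ‖x‖)⁻¹ * (1 + ‖x‖) ^ (n + 1)
      ≤ 2 * (Real.exp ‖x‖)⁻¹ * (Real.exp 1 * Real.exp ‖x‖ * (n + 1).factorial) := by gcongr
    _ = _ := by field_simp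

theorem norm_multiDeriv_mul_exp_le {n m : ℕ} (Φ : WeightFamily) (ν : ℕ)
    {f : EuclideanSpace ℝ (Fin n) → ℂ} {P : ℝ}
    (hP : ∀ t : GIndex n m, gTerm (Φ.psiStar ν) f t ≤ P) {α : Fin n → ℕ} (hα : ∑ i, α i ≤ m)
    (x : EuclideanSpace ℝ (Fin n)) {t : ℝ} (ht : 0 ≤ t) :
    ‖multiDeriv α f x‖ * Real.exp (t * ‖x‖) ≤
      P * Real.exp (Φ ν (2 * (n + 1) * (t + 1))) * decayConst n * japDecay n x := by
  have hP0 : 0 ≤ P := (gTerm_nonneg _ f _).trans (hP (x, ⟨α, hα⟩, 0))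
  set s : ℝ := 2 * (n + 1) * (t + 1) with hs
  have hs1 : 1 ≤ s := by
    have : (0 : ℝ) ≤ n := n.cast_nonneg
    nlinarith [mul_nonneg this ht]
  have h1 : ‖multiDeriv α f x‖ * Real.exp ((t + 1) * ‖x‖) ≤ P * Real.exp (Φ ν s) * 2 := by
    have hexp : HasSum (fun b : ℕ => ((t + 1) * ‖x‖) ^ b / b.factorial)
        (Real.exp ((t + 1) * ‖x‖)) := by
      rw [Real.exp_eq_exp_ℝ]; exact NormedSpace.expSeries_div_hasSum_exp _
    refine hasSum_le (fun b => ?_) (hexp.mul_left _) (hasSum_geometric_two.mul_left _)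
    have h2 := norm_multiDeriv_mul_le Φ ν hP hα x b hs1
    rw [hs, mul_pow, mul_pow, ← hs] at h2
    rw [← mul_div_assoc, div_le_iff₀ (by positivity), one_div, inv_pow, mul_pow]
    have h3 : (0 : ℝ) < (n + 1) ^ b := by positivity
    refine le_of_mul_le_mul_left ?_ (mul_pos h3 (pow_pos two_pos b))
    calc _ = ‖multiDeriv α f x‖ * ‖x‖ ^ b * (2 ^ b * (n + 1) ^ b * (t + 1) ^ b) := by ring
      _ ≤ _ := h2
      _ = _ := by field_simp
  calc ‖multiDeriv α f x‖ * Real.exp (t * ‖x‖)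
      = (‖multiDeriv α f x‖ * Real.exp ((t + 1) * ‖x‖)) * Real.exp (-‖x‖) := by
        rw [mul_assoc, ← Real.exp_add]; congr 2; ring
    _ ≤ P * Real.exp (Φ ν s) * 2 * Real.exp (-‖x‖) := by gcongr
    _ = P * Real.exp (Φ ν s) * (2 * Real.exp (-‖x‖)) := by ring
    _ ≤ P * Real.exp (Φ ν s) * (decayConst n * japDecay n x) := by
        exact mul_le_mul_of_nonneg_left (exp_neg_norm_le x) (by positivity)
    _ = _ := by ring

/-- Decay faster than every exponential. -/
def SuperExpDecay {n : ℕ} (H : EuclideanSpace ℝ (Fin n) → ℂ) : Prop :=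
  ∀ t : ℝ, 0 ≤ t → ∃ A : ℝ, ∀ x, ‖H x‖ * Real.exp (t * ‖x‖) ≤ A * japDecay n x

theorem superExpDecay_multiDeriv {n : ℕ} {Φ : WeightFamily} {ν : ℕ}
    {f : EuclideanSpace ℝ (Fin n) → ℂ} (hf : f ∈ gSubmodule n (Φ.psiStar ν)) (α : Fin n → ℕ) :
    SuperExpDecay (multiDeriv α f) := fun _ ht =>
  have ⟨_, hP⟩ := hf.2 (∑ i, α i)
  ⟨_, fun x => norm_multiDeriv_mul_exp_le Φ ν (fun t => hP ⟨t, rfl⟩) le_rfl x ht⟩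

theorem multiDeriv_single {n : ℕ} (j : Fin n) (k : ℕ) (f : EuclideanSpace ℝ (Fin n) → ℂ) :
    multiDeriv (Pi.single j k) f = (partialDeriv j)^[k] f := by
  have hnot : ∀ l : List (Fin n), j ∉ l →
      l.foldr (fun i g => (partialDeriv i)^[(Pi.single j k : Fin n → ℕ) i] g) f = f := by
    intro l
    induction l with
    | nil => intro _; rfl
    | cons i l ih =>
      intro h
      rw [List.mem_cons, not_or] at h
      rw [List.foldr_cons, ih h.2, Pi.single_eq_of_ne (Ne.symm h.1)]
      rfl
  have hmem : ∀ l : List (Fin n), l.Nodup → j ∈ l →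
      l.foldr (fun i g => (partialDeriv i)^[(Pi.single j k : Fin n → ℕ) i] g) f =
        (partialDeriv j)^[k] f := by
    intro l
    induction l with
    | nil => intro _ h; simp at h
    | cons i l ih =>
      intro hl h
      rw [List.nodup_cons] at hl
      rw [List.foldr_cons]
      rcases eq_or_ne i j with rfl | hij
      · rw [hnot l hl.1, Pi.single_eq_same]
      · rw [ih hl.2 ((List.mem_cons.1 h).resolve_left (Ne.symm hij)), Pi.single_eq_of_ne hij]
        rfl
  exact hmem _ (List.nodup_finRange n) (List.mem_finRange j)

theorem multiDeriv_zero {n : ℕ} (f : EuclideanSpace ℝ (Fin n) → ℂ) : multiDeriv 0 f = f := by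
  unfold multiDeriv
  generalize List.finRange n = l
  induction l with
  | nil => rfl
  | cons j l ih => rw [List.foldr_cons, ih]; rfl

open MeasureTheory

/-- The integrand `x ↦ H(x) e^{i⟨x, z⟩}`. -/
def invIntegrand {n : ℕ} (H : EuclideanSpace ℝ (Fin n) → ℂ) (z : EuclideanSpace ℂ (Fin n))
    (x : EuclideanSpace ℝ (Fin n)) : ℂ := H x * Complex.exp (Complex.I * cpair x z)

/-- The inverse Fourier transform `z ↦ (2π)^{-n} ∫ H(x) e^{i⟨x, z⟩} dx` on `ℂⁿ`. -/
def invHat {n : ℕ} (H : EuclideanSpace ℝ (Fin n) → ℂ) (z : EuclideanSpace ℂ (Fin n)) : ℂ :=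
  (((2 * Real.pi) ^ n)⁻¹ : ℝ) • ∫ x, invIntegrand H z x

theorem norm_cexp_I_cpair_le {n : ℕ} (x : EuclideanSpace ℝ (Fin n))
    (z : EuclideanSpace ℂ (Fin n)) :
    ‖Complex.exp (Complex.I * cpair x z)‖ ≤ Real.exp (‖imVec z‖ * ‖x‖) := by
  rw [norm_cexp_I_cpair, mul_comm]
  exact Real.exp_le_exp.2 ((neg_le_abs _).trans (abs_real_inner_le_norm _ _))

theorem norm_invIntegrand_le {n : ℕ} (H : EuclideanSpace ℝ (Fin n) → ℂ)
    (z : EuclideanSpace ℂ (Fin n)) (x : EuclideanSpace ℝ (Fin n)) :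
    ‖invIntegrand H z x‖ ≤ ‖H x‖ * Real.exp (‖imVec z‖ * ‖x‖) := by
  rw [invIntegrand, norm_mul]
  gcongr
  exact norm_cexp_I_cpair_le x z

theorem continuous_cpair {n : ℕ} :
    Continuous (cpair : EuclideanSpace ℝ (Fin n) → EuclideanSpace ℂ (Fin n) →L[ℂ] ℂ) :=
  (innerSL ℂ (E := EuclideanSpace ℂ (Fin n))).continuous.comp continuous_realToComplex

theorem continuous_invIntegrand {n : ℕ} {H : EuclideanSpace ℝ (Fin n) → ℂ} (hH : Continuous H)
    (z : EuclideanSpace ℂ (Fin n)) : Continuous (invIntegrand H z) :=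
  hH.mul (Complex.continuous_exp.comp
    (continuous_const.mul (continuous_cpair.clm_apply continuous_const)))

theorem integrable_invIntegrand {n : ℕ} {H : EuclideanSpace ℝ (Fin n) → ℂ} (hH : Continuous H)
    (hd : SuperExpDecay H) (z : EuclideanSpace ℂ (Fin n)) : Integrable (invIntegrand H z) := by
  obtain ⟨A, hA⟩ := hd ‖imVec z‖ (norm_nonneg _)
  exact ((integrable_japDecay n).const_mul A).mono' (continuous_invIntegrand hH z).aestronglyMeasurable
    (Filter.Eventually.of_forall fun x => (norm_invIntegrand_le H z x).trans (hA x))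

theorem norm_invHat_le {n : ℕ} {H : EuclideanSpace ℝ (Fin n) → ℂ} {z : EuclideanSpace ℂ (Fin n)}
    {A : ℝ} (hA : ∀ x, ‖H x‖ * Real.exp (‖imVec z‖ * ‖x‖) ≤ A * japDecay n x) :
    ‖invHat H z‖ ≤ ((2 * Real.pi) ^ n)⁻¹ * (A * ∫ x, japDecay n x) := by
  rw [invHat, norm_smul, Real.norm_of_nonneg (by positivity), ← integral_const_mul]
  gcongr
  exact norm_integral_le_of_norm_le ((integrable_japDecay n).const_mul _)
    (Filter.Eventually.of_forall fun x => (norm_invIntegrand_le H z x).trans (hA x))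

theorem differentiable_invHat {n : ℕ} {H : EuclideanSpace ℝ (Fin n) → ℂ} (hH : Continuous H)
    (hd : SuperExpDecay H) : Differentiable ℂ (invHat H) := by
  suffices h : Differentiable ℂ fun z => ∫ x, invIntegrand H z x by
    exact h.const_smul (((2 * Real.pi) ^ n)⁻¹ : ℝ)
  intro z₀
  obtain ⟨A, hA⟩ := hd (‖z₀‖ + 2) (by positivity)
  refine (hasFDerivAt_integral_of_dominated_of_fderiv_le (𝕜 := ℂ) (μ := volume)
    (bound := fun x => A * japDecay n x)
    (F' := fun z x => invIntegrand H z x • (Complex.I • cpair x))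
    (Metric.ball_mem_nhds z₀ one_pos)
    (Filter.Eventually.of_forall fun z => (continuous_invIntegrand hH z).aestronglyMeasurable)
    (integrable_invIntegrand hH hd z₀) ?_ ?_ ((integrable_japDecay n).const_mul A) ?_).differentiableAt
  · have h1 : Continuous fun x : EuclideanSpace ℝ (Fin n) =>
        (Complex.I • cpair x : EuclideanSpace ℂ (Fin n) →L[ℂ] ℂ) :=
      continuous_cpair.const_smul Complex.I
    have h2 : Continuous fun x : EuclideanSpace ℝ (Fin n) =>
        (invIntegrand H z₀ x • (Complex.I • cpair x) : EuclideanSpace ℂ (Fin n) →L[ℂ] ℂ) :=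
      (continuous_invIntegrand hH z₀).smul h1
    exact h2.aestronglyMeasurable
  · refine Filter.Eventually.of_forall fun x z hz => ?_
    have hz' : ‖z - z₀‖ < 1 := by simpa [dist_eq_norm] using hz
    have hz2 : ‖imVec z‖ ≤ ‖z₀‖ + 1 := by
      refine (norm_imVec_le z).trans ?_
      have := norm_sub_norm_le z z₀
      linarith
    rw [norm_smul, norm_smul, Complex.norm_I, one_mul]
    calc ‖invIntegrand H z x‖ * ‖cpair x‖
        ≤ (‖H x‖ * Real.exp ((‖z₀‖ + 1) * ‖x‖)) * Real.exp ‖x‖ := by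
          gcongr
          · exact (norm_invIntegrand_le H z x).trans (by gcongr)
          · exact (norm_cpair_le x).trans ((le_add_of_nonneg_right zero_le_one).trans
              (Real.add_one_le_exp _))
      _ = ‖H x‖ * Real.exp ((‖z₀‖ + 2) * ‖x‖) := by
          rw [mul_assoc, ← Real.exp_add]; congr 2; ring
      _ ≤ _ := hA x
  · refine Filter.Eventually.of_forall fun x z _ => ?_
    have h1 : HasFDerivAt (fun z => Complex.I * cpair x z) (Complex.I • cpair x) z :=
      (cpair x).hasFDerivAt.const_mul _
    have h2 := h1.cexp.const_mul (H x)
    refine h2.congr_fderiv ?_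
    rw [smul_smul]; rfl

theorem coord_mul_invHat {n : ℕ} {H : EuclideanSpace ℝ (Fin n) → ℂ} (hH : ContDiff ℝ ∞ H)
    (hd : SuperExpDecay H) (j : Fin n) (hd' : SuperExpDecay (partialDeriv j H))
    (z : EuclideanSpace ℂ (Fin n)) :
    z j * invHat H z = Complex.I * invHat (partialDeriv j H) z := by
  set e : EuclideanSpace ℝ (Fin n) → ℂ := fun x => Complex.exp (Complex.I * cpair x z) with he
  set v : EuclideanSpace ℝ (Fin n) := EuclideanSpace.single j 1 with hv
  have hHd : Differentiable ℝ H := hH.differentiable (by simp)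
  have hpd := partialDeriv_eq_fderiv j hH
  have hcv : cpair v z = z j := by
    rw [cpair_apply, Finset.sum_eq_single j (fun i _ hi => by simp [hv, hi]) (by simp)]
    simp [hv]
  have hlin : ∀ x, HasLineDerivAt ℝ e (Complex.I * z j * e x) x v := by
    intro x
    have h1 : HasDerivAt (fun t : ℝ => Complex.I * (cpair x z + t * z j)) (Complex.I * z j) 0 := by
      have := (((Complex.ofRealCLM.hasDerivAt (x := 0)).mul_const (z j)).const_add
        (cpair x z)).const_mul Complex.I
      simpa using this
    have h2 := h1.cexp
    have h3 : (fun t : ℝ => e (x + t • v)) =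
        fun t : ℝ => Complex.exp (Complex.I * (cpair x z + t * z j)) := by
      funext t
      simp only [he, ← hcv, cpair, realToComplex_add, realToComplex_smul, map_add, map_smulₛₗ]
      simp
    rw [HasLineDerivAt, h3]
    convert! h2 using 1
    simp [he]; ring
  have hI := integrable_invIntegrand hH.continuous hd z
  have hI' := integrable_invIntegrand (contDiff_partialDeriv j hH).continuous hd' z
  have hparts := integral_bilinear_hasLineDerivAt_right_eq_neg_left_of_integrable (μ := volume)
    (B := ContinuousLinearMap.mul ℝ ℂ) (f := H) (f' := partialDeriv j H) (g := e)
    (g' := fun x => Complex.I * z j * e x) (v := v) hI' ?_ hI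
    (fun x _ => by
      rw [hpd]; exact (hHd x).hasFDerivAt.hasLineDerivAt v) (fun x _ => hlin x)
  · simp only [ContinuousLinearMap.mul_apply'] at hparts
    have h1 : ∫ x, H x * (Complex.I * z j * e x) = Complex.I * z j * ∫ x, invIntegrand H z x := by
      rw [← integral_const_mul]
      exact integral_congr_ae (Filter.Eventually.of_forall fun x => by
        simp only [invIntegrand, he]; ring)
    rw [h1] at hparts
    have h2 : ∫ x, partialDeriv j H x * e x = ∫ x, invIntegrand (partialDeriv j H) z x := rfl
    rw [h2] at hparts
    simp only [invHat, Complex.real_smul]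
    have h3 : ∫ x, invIntegrand (partialDeriv j H) z x =
      -(Complex.I * z j * ∫ x, invIntegrand H z x) := by rw [hparts, neg_neg]
    rw [h3]
    linear_combination ((z j) * (((2 * Real.pi) ^ n)⁻¹ : ℝ) *
      ∫ x, invIntegrand H z x) * Complex.I_mul_I
  · refine (hI.const_mul (Complex.I * z j)).congr (Filter.Eventually.of_forall fun x => ?_)
    simp only [invIntegrand, he, ContinuousLinearMap.mul_apply']; ring

theorem coord_pow_mul_invHat {n : ℕ} {H : EuclideanSpace ℝ (Fin n) → ℂ} (hH : ContDiff ℝ ∞ H)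
    (j : Fin n) (hd : ∀ k, SuperExpDecay ((partialDeriv j)^[k] H))
    (z : EuclideanSpace ℂ (Fin n)) (k : ℕ) :
    z j ^ k * invHat H z = Complex.I ^ k * invHat ((partialDeriv j)^[k] H) z := by
  induction k with
  | zero => simp
  | succ k ih =>
    have h := coord_mul_invHat (iterate_partialDeriv j k 0 hH hH).1 (hd k) j
      (by rw [← Function.iterate_succ_apply' (partialDeriv j)]; exact hd (k + 1)) z
    rw [pow_succ', mul_assoc, ih, Function.iterate_succ_apply', mul_left_comm, h]
    ring

/-- The condition `φ_m(2x) ≤ φ_{m+1}(x) + a_m`. -/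
def WeightFamily.Doubling (Φ : WeightFamily) : Prop :=
  ∀ m : ℕ, ∃ a : ℝ, 0 < a ∧ ∀ x : ℝ, 0 ≤ x → Φ m (2 * x) ≤ Φ (m + 1) x + a

theorem WeightFamily.Doubling.two_pow {Φ : WeightFamily} (h : Φ.Doubling) (k ν : ℕ) :
    ∃ C : ℝ, ∀ x : ℝ, 0 ≤ x → Φ ν (2 ^ k * x) ≤ Φ (ν + k) x + C := by
  induction k generalizing ν with
  | zero => exact ⟨0, fun x _ => by simp⟩
  | succ k ih =>
    obtain ⟨C, hC⟩ := ih (ν + 1)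
    obtain ⟨a, -, ha⟩ := h ν
    refine ⟨C + a, fun x hx => ?_⟩
    have h1 := ha (2 ^ k * x) (by positivity)
    have h2 := hC x hx
    rw [show ν + 1 + k = ν + (k + 1) by ring] at h2
    rw [pow_succ', mul_assoc]
    linarith

theorem WeightFamily.Doubling.affine {Φ : WeightFamily} (h : Φ.Doubling) (n ν : ℕ) :
    ∃ C : ℝ, ∀ t : ℝ, 0 ≤ t →
      Φ ν (2 * (n + 1) * (t + 1)) ≤ Φ (ν + 4 * (n + 1)) t + C := by
  obtain ⟨C, hC⟩ := h.two_pow (4 * (n + 1)) ν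
  set q : ℝ := 2 ^ (4 * (n + 1)) with hq
  have hq4 : 4 * (n + 1 : ℝ) ≤ q := by
    have : 4 * (n + 1) ≤ 2 ^ (4 * (n + 1)) := Nat.lt_two_pow_self.le
    rw [hq]; exact_mod_cast this
  have hn : (0 : ℝ) ≤ n := n.cast_nonneg
  have hmono := Φ.monotoneOn ν
  have hq0 : 0 ≤ q := by positivity
  refine ⟨C + (Φ ν q - Φ ν 0), fun t ht => ?_⟩
  have h1 := hC t ht
  have h0 : Φ ν 0 ≤ Φ ν (q * t) := hmono (Set.mem_Ici.2 le_rfl)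
    (Set.mem_Ici.2 (by positivity)) (by positivity)
  have h0' : Φ ν 0 ≤ Φ ν q := hmono (Set.mem_Ici.2 le_rfl) (Set.mem_Ici.2 hq0) hq0
  rcases le_total t 1 with h2 | h2
  · have : Φ ν (2 * (n + 1) * (t + 1)) ≤ Φ ν q :=
      hmono (Set.mem_Ici.2 (by positivity)) (Set.mem_Ici.2 hq0) (by nlinarith)
    linarith
  · have : Φ ν (2 * (n + 1) * (t + 1)) ≤ Φ ν (q * t) :=
      hmono (Set.mem_Ici.2 (by positivity)) (Set.mem_Ici.2 (by positivity)) (by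
        calc 2 * (n + 1) * (t + 1) ≤ 2 * (n + 1) * (t + t) := by gcongr
          _ = 4 * (n + 1) * t := by ring
          _ ≤ q * t := by gcongr)
    linarith

theorem exists_eTerm_invHat_le {n : ℕ} {Φ : WeightFamily} (h : Φ.Doubling) (ν k : ℕ) :
    ∃ K : ℝ, 0 ≤ K ∧ ∀ f ∈ gSubmodule n (Φ.psiStar ν), ∀ P : ℝ,
      (∀ t : GIndex n k, gTerm (Φ.psiStar ν) f t ≤ P) →
      ∀ z, eTerm (Φ (ν + 4 * (n + 1))) k (invHat f) z ≤ K * P := by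
  obtain ⟨C, hC⟩ := h.affine n ν
  set J : ℝ := ∫ x, japDecay n x with hJ
  have hJ0 : 0 ≤ J := MeasureTheory.integral_nonneg fun ξ => (japDecay_pos ξ).le
  have hD := decayConst_pos n
  refine ⟨(n + 1 : ℝ) ^ k * (((2 * Real.pi) ^ n)⁻¹ * (Real.exp C * decayConst n * J)),
    by positivity, fun f hf P hP z => ?_⟩
  rw [norm_mul_pow_le_of_eTerm_le]
  have hP0 : 0 ≤ P := (gTerm_nonneg _ f (0, ⟨0, by simp⟩, 0)).trans (hP _)
  have key : ∀ α : Fin n → ℕ, ∑ i, α i ≤ k → ‖invHat (multiDeriv α f) z‖ ≤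
      ((2 * Real.pi) ^ n)⁻¹ * (Real.exp C * decayConst n * J) * P *
        Real.exp (Φ (ν + 4 * (n + 1)) ‖imVec z‖) := by
    intro α hα
    refine (norm_invHat_le fun x =>
      norm_multiDeriv_mul_exp_le Φ ν hP hα x (norm_nonneg (imVec z))).trans ?_
    have h1 : Real.exp (Φ ν (2 * (n + 1) * (‖imVec z‖ + 1))) ≤
        Real.exp (Φ (ν + 4 * (n + 1)) ‖imVec z‖) * Real.exp C := by
      rw [← Real.exp_add]; exact Real.exp_le_exp.2 (hC _ (norm_nonneg _))
    rw [← hJ]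
    calc _ ≤ ((2 * Real.pi) ^ n)⁻¹ * (P * (Real.exp (Φ (ν + 4 * (n + 1)) ‖imVec z‖) *
          Real.exp C) * decayConst n * J) := by gcongr
      _ = _ := by ring
  obtain ⟨o, ho⟩ := Finite.exists_max fun o : Option (Fin n) => o.elim 1 fun j => ‖z j‖
  set a : ℝ := o.elim 1 fun j => ‖z j‖ with ha
  have ha1 : 1 ≤ a := ho none
  have hz : 1 + ‖z‖ ≤ (n + 1) * a := by
    have := euclidean_norm_le_of_forall_le (zero_le_one.trans ha1) fun j => ho (some j)
    linarith
  have hbound : ‖invHat f z‖ * a ^ k ≤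
      ((2 * Real.pi) ^ n)⁻¹ * (Real.exp C * decayConst n * J) * P *
        Real.exp (Φ (ν + 4 * (n + 1)) ‖imVec z‖) := by
    cases o with
    | none =>
      have h1 := key 0 (by simp)
      rw [multiDeriv_zero] at h1
      simpa [ha] using h1
    | some j =>
      have h1 := key (Pi.single j k) (by simp)
      rw [multiDeriv_single] at h1
      have h2 := coord_pow_mul_invHat hf.1 j
        (fun k => multiDeriv_single j k f ▸ superExpDecay_multiDeriv hf _) z k
      have h3 := congrArg norm h2
      rw [norm_mul, norm_mul, norm_pow, norm_pow, Complex.norm_I, one_pow, one_mul] at h3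
      rw [← h3, mul_comm] at h1
      exact h1
  calc ‖invHat f z‖ * (1 + ‖z‖) ^ k ≤ ‖invHat f z‖ * ((n + 1) * a) ^ k := by gcongr
    _ = (n + 1 : ℝ) ^ k * (‖invHat f z‖ * a ^ k) := by rw [mul_pow]; ring
    _ ≤ _ := mul_le_mul_of_nonneg_left hbound (by positivity)
    _ = _ := by ring

theorem superExpDecay_of_mem {n : ℕ} {Φ : WeightFamily} {ν : ℕ}
    {f : EuclideanSpace ℝ (Fin n) → ℂ} (hf : f ∈ gSubmodule n (Φ.psiStar ν)) :
    SuperExpDecay f := multiDeriv_zero f ▸ superExpDecay_multiDeriv hf 0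

theorem invHat_mem_eSubmodule {n : ℕ} {Φ : WeightFamily} (h : Φ.Doubling) {ν : ℕ}
    {f : EuclideanSpace ℝ (Fin n) → ℂ} (hf : f ∈ gSubmodule n (Φ.psiStar ν)) :
    invHat f ∈ eSubmodule n (Φ (ν + 4 * (n + 1))) := by
  refine ⟨differentiable_invHat hf.1.continuous (superExpDecay_of_mem hf), fun k => ?_⟩
  obtain ⟨K, -, hK⟩ := exists_eTerm_invHat_le (n := n) h ν k
  obtain ⟨P, hP⟩ := hf.2 k
  refine ⟨K * P, ?_⟩
  rintro _ ⟨z, rfl⟩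
  exact hK f hf P (fun t => hP ⟨t, rfl⟩) z

open MeasureTheory

theorem SuperExpDecay.integrable {n : ℕ} {H : EuclideanSpace ℝ (Fin n) → ℂ}
    (hd : SuperExpDecay H) (hH : Continuous H) : Integrable H := by
  have h := integrable_invIntegrand hH hd 0
  refine h.congr (Filter.Eventually.of_forall fun x => ?_)
  simp [invIntegrand]

open Real FourierTransform

theorem invHat_realToComplex {n : ℕ} (H : EuclideanSpace ℝ (Fin n) → ℂ)
    (ξ : EuclideanSpace ℝ (Fin n)) :
    invHat H (realToComplex ξ) = 𝓕⁻ (fun y => H ((2 * π) • y)) ξ := by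
  rw [fourierInv_eq']
  have h := Measure.integral_comp_smul volume (invIntegrand H (realToComplex ξ)) (2 * π)
  rw [invHat]
  rw [finrank_euclideanSpace_fin, abs_of_nonneg (by positivity)] at h
  rw [← h]
  congr 1
  funext y
  rw [invIntegrand, smul_eq_mul, mul_comm, cpair_realToComplex, real_inner_eq_sum]
  congr 2
  have : ∑ j, ((2 * π) • y) j * ξ j = 2 * π * ∑ j, y j * ξ j := by
    rw [Finset.mul_sum]
    exact Finset.sum_congr rfl fun j _ => by simp [mul_assoc]
  rw [this, mul_comm]

theorem fourierHat_invHat {n : ℕ} {Φ : WeightFamily} (h : Φ.Doubling) {ν : ℕ}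
    {f : EuclideanSpace ℝ (Fin n) → ℂ} (hf : f ∈ gSubmodule n (Φ.psiStar ν)) :
    fourierHat (invHat f) = f := by
  set G : EuclideanSpace ℝ (Fin n) → ℂ := fun y => f ((2 * π) • y) with hG
  have h2π : (2 * π) ≠ 0 := by positivity
  have hinv : (fun ξ => invHat f (realToComplex ξ)) = 𝓕⁻ G := funext (invHat_realToComplex f)
  have hint := integrable_restrict (invHat_mem_eSubmodule h hf)
  have hGc : Continuous G := hf.1.continuous.comp (continuous_const_smul _)
  have hGi : Integrable G :=
    ((superExpDecay_of_mem hf).integrable hf.1.continuous).comp_smul h2π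
  have hFG : Integrable (𝓕 G) := by
    rw [hinv] at hint
    refine hint.comp_neg.congr (Filter.Eventually.of_forall fun ξ => ?_)
    simp only [fourierInv_eq_fourier_neg, neg_neg]
  funext x
  rw [fourierHat_eq_fourier, hinv, hGc.fourier_fourierInv_eq hGi hFG]
  rw [hG]
  simp only [smul_smul, mul_inv_cancel₀ h2π, one_smul]

theorem eq_of_fourierHat_eq {n : ℕ} {Φ : WeightFamily} {ν μ : ℕ}
    {f g : EuclideanSpace ℂ (Fin n) → ℂ} (hf : f ∈ eSubmodule n (Φ ν))
    (hg : g ∈ eSubmodule n (Φ μ)) (hfg : fourierHat f = fourierHat g) : f = g := by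
  have h2π : (2 * π) ≠ 0 := by positivity
  have hF : ∀ f : EuclideanSpace ℂ (Fin n) → ℂ,
      𝓕 (fun ξ => f (realToComplex ξ)) = fun y => fourierHat f ((2 * π) • y) := by
    intro f
    funext y
    rw [fourierHat_eq_fourier, smul_smul, inv_mul_cancel₀ h2π, one_smul]
  have hinv : ∀ (ν : ℕ) (f : EuclideanSpace ℂ (Fin n) → ℂ), f ∈ eSubmodule n (Φ ν) →
      𝓕⁻ (fun y => fourierHat f ((2 * π) • y)) = fun ξ => f (realToComplex ξ) := by
    intro ν f hf
    have hG := fourierHat_mem_gSubmodule Φ ν hf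
    rw [← hF f]
    refine (hf.1.continuous.comp continuous_realToComplex).fourierInv_fourier_eq
      (integrable_restrict hf) ?_
    change Integrable (𝓕 fun ξ => f (realToComplex ξ))
    rw [hF f]
    exact ((superExpDecay_of_mem hG).integrable hG.1.continuous).comp_smul h2π
  refine eq_of_eq_on_real hf.1 hg.1 fun x => ?_
  have h1 := hinv ν f hf
  rw [hfg, hinv μ g hg] at h1
  exact (congrFun h1 x).symm

theorem fourierHat_add {n : ℕ} {Φ : WeightFamily} {ν μ : ℕ}
    {f g : EuclideanSpace ℂ (Fin n) → ℂ} (hf : f ∈ eSubmodule n (Φ ν))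
    (hg : g ∈ eSubmodule n (Φ μ)) : fourierHat (f + g) = fourierHat f + fourierHat g := by
  funext x
  rw [Pi.add_apply, fourierHat, fourierHat, fourierHat,
    ← integral_add (integrable_fourierIntegrand hf x) (integrable_fourierIntegrand hg x)]
  congr 1
  funext ξ
  simp only [fourierIntegrand, Pi.add_apply, add_mul]

theorem fourierHat_smul {n : ℕ} (c : ℂ) (f : EuclideanSpace ℂ (Fin n) → ℂ) :
    fourierHat (c • f) = c • fourierHat f := by
  funext x
  rw [Pi.smul_apply, fourierHat, fourierHat, ← integral_smul]
  congr 1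
  funext ξ
  simp only [fourierIntegrand, Pi.smul_apply, smul_eq_mul, mul_assoc]

/-- The Fourier transformation `E(Φ) → G(Ψ*)`. -/
def fourierMap (n : ℕ) (Φ : WeightFamily) : ESpace n Φ →ₗ[ℂ] GSpace n Φ where
  toFun f := ⟨fourierHat f.1, f.2.imp fun ν hf => fourierHat_mem_gSubmodule Φ ν hf⟩
  map_add' f g := by
    obtain ⟨ν, hf⟩ := f.2
    obtain ⟨μ, hg⟩ := g.2
    exact Subtype.ext (fourierHat_add hf hg)
  map_smul' c f := Subtype.ext (fourierHat_smul c f.1)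

/-- The Fourier transformation `E(φ_ν) → G(ψ_ν*)`. -/
def fourierStep (n : ℕ) (Φ : WeightFamily) (ν : ℕ) :
    EStep n (Φ ν) →ₗ[ℂ] GStep n (Φ.psiStar ν) where
  toFun f := ⟨fourierHat f.1, fourierHat_mem_gSubmodule Φ ν f.2⟩
  map_add' f g := Subtype.ext (fourierHat_add f.2 g.2)
  map_smul' c f := Subtype.ext (fourierHat_smul c f.1)

theorem continuous_fourierStep (n : ℕ) (Φ : WeightFamily) (ν : ℕ) :
    Continuous (fourierStep n Φ ν) :=
  continuous_of_seminorm_le (withSeminorms_eNorm n _) (withSeminorms_gNorm n _) _ fun m =>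
    ⟨n + 1 + m, ∫ ξ, japDecay n ξ, integral_nonneg fun ξ => (japDecay_pos ξ).le, fun f =>
      gNorm_le fun t => gTerm_fourierHat_le Φ ν f.2 (eTerm_le_eNorm (n + 1 + m) f) t⟩

theorem continuous_fourierMap (n : ℕ) (Φ : WeightFamily) : Continuous (fourierMap n Φ) :=
  continuous_of_indLim (eIncl n Φ) (indLim_isTopologicalAddGroup (gIncl n Φ))
    (indLim_continuousSMul (gIncl n Φ)) (indLim_locallyConvexSpace (gIncl n Φ)) _ fun ν =>
    (continuous_indLim_incl (gIncl n Φ) ν).comp (continuous_fourierStep n Φ ν)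

theorem fourierMap_bijective {n : ℕ} {Φ : WeightFamily} (h : Φ.Doubling) :
    Function.Bijective (fourierMap n Φ) := by
  refine ⟨fun f g hfg => ?_, fun g => ?_⟩
  · obtain ⟨ν, hf⟩ := f.2
    obtain ⟨μ, hg⟩ := g.2
    exact Subtype.ext (eq_of_fourierHat_eq hf hg (congrArg Subtype.val hfg))
  · obtain ⟨ν, hg⟩ := g.2
    exact ⟨⟨invHat g.1, ν + 4 * (n + 1), invHat_mem_eSubmodule h hg⟩,
      Subtype.ext (fourierHat_invHat h hg)⟩

/-- The Fourier transformation as a linear bijection. -/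
def fourierSpaceEquiv {n : ℕ} {Φ : WeightFamily} (h : Φ.Doubling) : ESpace n Φ ≃ₗ[ℂ] GSpace n Φ :=
  LinearEquiv.ofBijective (fourierMap n Φ) (fourierMap_bijective h)

theorem fourierSpaceEquiv_symm_val {n : ℕ} {Φ : WeightFamily} (h : Φ.Doubling) {ν : ℕ}
    (g : GStep n (Φ.psiStar ν)) : ((fourierSpaceEquiv h).symm (gIncl n Φ ν g)).1 = invHat g.1 := by
  have hS : (fourierSpaceEquiv h).symm (gIncl n Φ ν g) =
      ⟨invHat g.1, ν + 4 * (n + 1), invHat_mem_eSubmodule h g.2⟩ := by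
    refine (LinearEquiv.symm_apply_eq _).2 ?_
    exact Subtype.ext (fourierHat_invHat h g.2).symm
  rw [hS]

/-- The inverse Fourier transformation on `G(ψ_ν*)`. -/
def invFourierStep {n : ℕ} {Φ : WeightFamily} (h : Φ.Doubling) (ν : ℕ) :
    GStep n (Φ.psiStar ν) →ₗ[ℂ] EStep n (Φ (ν + 4 * (n + 1))) where
  toFun g := ⟨invHat g.1, invHat_mem_eSubmodule h g.2⟩
  map_add' f g := by
    refine Subtype.ext ?_
    change invHat (f + g).1 = invHat f.1 + invHat g.1
    rw [← fourierSpaceEquiv_symm_val h, ← fourierSpaceEquiv_symm_val h, ← fourierSpaceEquiv_symm_val h, map_add,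
      map_add]
    rfl
  map_smul' c f := by
    refine Subtype.ext ?_
    change invHat (c • f).1 = c • invHat f.1
    rw [← fourierSpaceEquiv_symm_val h, ← fourierSpaceEquiv_symm_val h, map_smul, map_smul]
    rfl

theorem continuous_invFourierStep {n : ℕ} {Φ : WeightFamily} (h : Φ.Doubling) (ν : ℕ) :
    Continuous (invFourierStep (n := n) h ν) :=
  continuous_of_seminorm_le (withSeminorms_gNorm n _) (withSeminorms_eNorm n _) _ fun k =>
    have ⟨K, hK0, hK⟩ := exists_eTerm_invHat_le (n := n) h ν k
    ⟨k, K, hK0, fun f => eNorm_le (hK f.1 f.2 _ (gTerm_le_gNorm k f))⟩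

theorem continuous_fourierSpaceEquiv_symm {n : ℕ} {Φ : WeightFamily} (h : Φ.Doubling) :
    Continuous (fourierSpaceEquiv (n := n) h).symm := by
  refine continuous_of_indLim (gIncl n Φ) (indLim_isTopologicalAddGroup (eIncl n Φ))
    (indLim_continuousSMul (eIncl n Φ)) (indLim_locallyConvexSpace (eIncl n Φ))
    (fourierSpaceEquiv h).symm.toLinearMap fun ν => ?_
  have h1 : (fun g => (fourierSpaceEquiv h).symm.toLinearMap (gIncl n Φ ν g)) =
      fun g => eIncl n Φ (ν + 4 * (n + 1)) (invFourierStep h ν g) :=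
    funext fun g => Subtype.ext (fourierSpaceEquiv_symm_val h g)
  rw [h1]
  exact (continuous_indLim_incl (eIncl n Φ) _).comp (continuous_invFourierStep h ν)

end

theorem theorem3 (n : ℕ) (Φ : WeightFamily)
    (h3 : ∀ m : ℕ, ∃ a : ℝ, 0 < a ∧ ∀ x : ℝ, 0 ≤ x → Φ m (2 * x) ≤ Φ (m + 1) x + a)
    (h5 : ∀ m : ℕ, ∃ h l : ℝ, 1 < h ∧ 0 < l ∧
      ∀ x : ℝ, 0 ≤ x → 2 * Φ m x ≤ Φ (m + 1) (h * x) + l) :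
    (∀ (f : ESpace n Φ) (x : EuclideanSpace ℝ (Fin n)),
      MeasureTheory.Integrable (fourierIntegrand f x)) ∧
    ∃ T : ESpace n Φ ≃L[ℂ] GSpace n Φ,
      ∀ (f : ESpace n Φ) (x : EuclideanSpace ℝ (Fin n)), T f x = fourierHat f x := by
  refine ⟨fun f x => ?_, ⟨fourierSpaceEquiv h3, continuous_fourierMap n Φ,
    continuous_fourierSpaceEquiv_symm h3⟩, fun f x => rfl⟩
  obtain ⟨ν, hf⟩ := f.2
  exact integrable_fourierIntegrand hf x
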